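/- For $d\ge 1$ let $\hat f$ denote the Fourier transform $\hat f(\xi)=\int_{\mathbb R^d} f(x)e^{-2\pi i\xi\cdot x}\,dx$, extended to tempered distributions, and let $|\xi|_1=\sum_i|\xi_i|$. For a tempered distribution $f$ on $\mathbb R^d$ whose Fourier transform is a function, put $$\|f\|_{\mathscr B^{1}}=\int_{\mathbb R^d}(1+|\xi|_1)\,|\hat f(\xi)|\,d\xi,\qquad \|f\|_{\mathscr B^{1,\log}}=\int_{\mathbb R^d}(1+|\xi|_1)\log_2(2+|\xi|_1)\,|\hat f(\xi)|\,d\xi,$$ and let $\mathscr B^{1,\log}$ be the set of those $f$ with $\|f\|_{\mathscr B^{1,\log}}<\infty$. A ReLU network of width $N\ge1$ and depth $L\ge1$ is a function $F:\mathbb R^d\to\mathbb R$ of the form $$z_1=\mathrm{ReLU}(W_0x+b_1),\quad z_{l+1}=\mathrm{ReLU}(W_lz_l+b_{l+1})\ (1\le l<L),\quad F(x)=W_Lz_L,$$ where $W_0\in\mathbb R^{N\times d}$, $W_l\in\mathbb R^{N\times N}$ for $1\le l<L$, $W_L\in\mathbb R^{1\times N}$, $b_l\in\mathbb R^N$ for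 $1\le l\le L$, and $\mathrm{ReLU}(t)=\max\{0,t\}$ acts entrywise. **Corollary.** Let $d\ge1$, let $f\in\mathscr B^{1,\log}$ be real-valued and nonzero, let $\Omega\subset[0,1]^d$ be compact, and let $m\ge1$ be an integer. Then $f$ is (given by) a real-valued function on $\mathbb R^d$, and there is a ReLU network $F$ of width $d+4$ and of depth at most $$6m\,\frac{\|f\|_{\mathscr B^{1,\log}}}{\|f\|_{\mathscr B^{1}}}$$ such that $$\|f-F\|_{H^1(\Omega)}\le\frac{4\pi^2}{\sqrt m}\,|\Omega|^{1/2}\,\|f\|_{\mathscr B^1},$$ where $|\Omega|$ is the Lebesgue measure of $\Omega$ and $\|u\|_{H^1(\Omega)}^2=\|u\|_{L^2(\Omega)}^2+\sum_{j=1}^d\|D_ju\|_{L^2(\Omega)}^2$, with $D_ju$ the weak partial derivatives of $u$ on $\mathbb R^d$. -/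

import Mathlib

open MeasureTheory
open scoped SchwartzMap FourierTransform ENNReal ContDiff

noncomputable section

/-! ### Barron-type spaces of tempered distributions -/

/-- The tempered distribution `T` is the function `g`: `g` is locally integrable and
`T φ = ∫ φ g` for every Schwartz function `φ` (with `φ g` integrable). -/
def IsGivenByFunction {d : ℕ} (T : 𝓢'(EuclideanSpace ℝ (Fin d), ℂ))
    (g : EuclideanSpace ℝ (Fin d) → ℂ) : Prop :=
  LocallyIntegrable g ∧
    ∀ φ : 𝓢(EuclideanSpace ℝ (Fin d), ℂ),
      Integrable (fun x => φ x * g x) ∧ T φ = ∫ x, φ x * g x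

/-- A tempered distribution is real if it takes real values on real-valued Schwartz functions. -/
def IsRealDistribution {d : ℕ} (T : 𝓢'(EuclideanSpace ℝ (Fin d), ℂ)) : Prop :=
  ∀ φ : 𝓢(EuclideanSpace ℝ (Fin d), ℂ), (∀ x, (φ x).im = 0) → (T φ).im = 0

/-- The `ℓ¹`-norm of a vector. -/
def l1Norm {d : ℕ} (ξ : EuclideanSpace ℝ (Fin d)) : ℝ := ∑ i, |ξ i|

/-- `∫ w(ξ) |f̂(ξ)| dξ`, with value `∞` when the distribution `f̂` is not a function. The infimum
runs over the functions that represent `f̂`; any two of them agree almost everywhere. -/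
def weightedFourierNorm {d : ℕ} (w : EuclideanSpace ℝ (Fin d) → ℝ)
    (f : 𝓢'(EuclideanSpace ℝ (Fin d), ℂ)) : ℝ≥0∞ :=
  ⨅ (g : EuclideanSpace ℝ (Fin d) → ℂ) (_ : IsGivenByFunction (𝓕 f) g),
    ∫⁻ ξ, ENNReal.ofReal (w ξ) * ‖g ξ‖ₑ

/-- The Barron norm `∫ (1 + |ξ|₁ˢ) |f̂(ξ)| dξ`. -/
def barronNorm {d : ℕ} (s : ℝ) (f : 𝓢'(EuclideanSpace ℝ (Fin d), ℂ)) : ℝ≥0∞ :=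
  weightedFourierNorm (fun ξ => 1 + l1Norm ξ ^ s) f

/-- The log-Barron norm `∫ (1 + |ξ|₁ˢ) log₂ (2 + |ξ|₁) |f̂(ξ)| dξ`. -/
def logBarronNorm {d : ℕ} (s : ℝ) (f : 𝓢'(EuclideanSpace ℝ (Fin d), ℂ)) : ℝ≥0∞ :=
  weightedFourierNorm (fun ξ => (1 + l1Norm ξ ^ s) * Real.logb 2 (2 + l1Norm ξ)) f

/-- The log-Barron space: tempered distributions of finite log-Barron norm. -/
def logBarronSpace (d : ℕ) (s : ℝ) : Set 𝓢'(EuclideanSpace ℝ (Fin d), ℂ) :=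
  {f | logBarronNorm s f < ⊤}

/-! ### Deep ReLU networks -/

/-- The vector in the `(l + 1)`-st hidden layer of a ReLU network of width `N`
with input weights `W₀`, hidden weights `W` and biases `b`. -/
def hiddenLayer {d N : ℕ} (W₀ : Matrix (Fin N) (Fin d) ℝ) (W : ℕ → Matrix (Fin N) (Fin N) ℝ)
    (b : ℕ → Fin N → ℝ) (x : EuclideanSpace ℝ (Fin d)) : ℕ → Fin N → ℝ
  | 0 => fun i => max 0 ((W₀.mulVec (fun j => x j) + b 0) i)
  | l + 1 => fun i => max 0 (((W l).mulVec (hiddenLayer W₀ W b x l) + b (l + 1)) i)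

/-- `F` is a ReLU network of depth `L` (that is, with `L ≥ 1` hidden layers) and width `N`
(each hidden layer has `N` nodes), with a linear output layer without bias. -/
def IsReLUNetwork {d : ℕ} (L N : ℕ) (F : EuclideanSpace ℝ (Fin d) → ℝ) : Prop :=
  1 ≤ L ∧
    ∃ (W₀ : Matrix (Fin N) (Fin d) ℝ) (W : ℕ → Matrix (Fin N) (Fin N) ℝ)
      (b : ℕ → Fin N → ℝ) (v : Fin N → ℝ),
      ∀ x, F x = ∑ i, v i * hiddenLayer W₀ W b x (L - 1) i

/-! ### The Sobolev norm -/

/-- `v` is the weak partial derivative of `u` on `ℝᵈ` in the `j`-th coordinate. -/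
def IsWeakPartialDeriv {d : ℕ} (j : Fin d) (u v : EuclideanSpace ℝ (Fin d) → ℝ) : Prop :=
  LocallyIntegrable u ∧ LocallyIntegrable v ∧
    ∀ φ : EuclideanSpace ℝ (Fin d) → ℝ, ContDiff ℝ ∞ φ → HasCompactSupport φ →
      ∫ x, u x * fderiv ℝ φ x (EuclideanSpace.single j 1) = -∫ x, v x * φ x

/-- The norm `(‖u‖²_{L²(Ω)} + ∑ⱼ ‖Dⱼu‖²_{L²(Ω)})^{1/2}` of a function `u` on `ℝᵈ` with weak partial
derivatives `Dⱼu`, with value `∞` when these do not exist. The infimum runs over the weak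
gradients of `u`; any two of them agree almost everywhere. -/
def h1Norm {d : ℕ} (Ω : Set (EuclideanSpace ℝ (Fin d))) (u : EuclideanSpace ℝ (Fin d) → ℝ) :
    ℝ≥0∞ :=
  ⨅ (v : Fin d → EuclideanSpace ℝ (Fin d) → ℝ) (_ : ∀ j, IsWeakPartialDeriv j u (v j)),
    (eLpNorm u 2 (volume.restrict Ω) ^ 2
      + ∑ j, eLpNorm (v j) 2 (volume.restrict Ω) ^ 2) ^ (1 / 2 : ℝ)

end

/-! Let `g` be the Fourier density of `f` and `M` its Barron norm. Writing `g` in polar form, `f` is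
the superposition of the plane waves `cos (2π (ξ·x + θ ξ))` with amplitudes `|g ξ|`. The cosine is
itself an average of simple periodic functions: since `cos (2πt) = cos (π triWave t)`, Taylor's
formula with integral remainder gives `cos (2πt) = ∫₀¹ (1 - π² cos (πτ) rampWave τ t) dτ`
(`integral_cos_mul_rampWave`), and the derivative in `t` has the matching formula
(`integral_cos_mul_deriv_rampWave`).

Hence `f` and its gradient are the means of `rampFeature` over a random frequency, with density `(1
+ |ξ|₁) |g ξ| / M`, and a uniform random level `τ` (`integral_rampFeature`). The amplitude `M / (1 +
|ξ|₁)` bounds value and gradient together by `2π² M` (`sum_rampFeature_sq_le`), so averaging `m`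
samples gives squared `H¹` error of order `M² |Ω| / m`.

Each feature is cheap for a deep network. Composing tent maps doubles the frequency of the triangle
wave at each layer, so a frequency `ξ` costs about `log₂ (1 + |ξ|₁)` layers
(`NetworkState.exists_rampWave`). The features are computed one after another in the same `d + 4`
neurons and added to an accumulator (`exists_network_sum_rampWave`); the depth is therefore the sum
of the costs, whose mean is controlled by the log-Barron norm.
`exists_sample_sq_error_le_and_cost_le` selects samples for which error and depth are both at most
twice their mean bounds. -/

/-! ### The triangle wave -/

/-- The triangle wave of period `1`, twice the distance to the nearest integer. -/
noncomputable def triWave (t : ℝ) : ℝ := 2 * ‖(t : UnitAddCircle)‖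

theorem triWave_nonneg (t : ℝ) : 0 ≤ triWave t := by unfold triWave; positivity

theorem triWave_le_one (t : ℝ) : triWave t ≤ 1 := by
  have := AddCircle.norm_le_half_period 1 (x := (t : UnitAddCircle)) one_ne_zero
  unfold triWave
  rw [abs_one] at this
  linarith

theorem triWave_lipschitz : LipschitzWith 2 triWave := by
  refine LipschitzWith.of_dist_le_mul fun x y => ?_
  have h1 : |‖(x : UnitAddCircle)‖ - ‖(y : UnitAddCircle)‖| ≤ ‖((x - y : ℝ) : UnitAddCircle)‖ := by
    rw [AddCircle.coe_sub]
    exact abs_norm_sub_norm_le _ _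
  have h2 : ‖((x - y : ℝ) : UnitAddCircle)‖ ≤ |x - y| := by
    rw [UnitAddCircle.norm_eq]
    simpa using round_le (x - y) 0
  simp only [Real.dist_eq, triWave, ← mul_sub, abs_mul, abs_two]
  push_cast
  linarith

theorem triWave_add_int (t : ℝ) (n : ℤ) : triWave (t + n) = triWave t := by
  simp [triWave]

theorem triWave_of_abs_le {t : ℝ} (ht : |t| ≤ 1 / 2) : triWave t = 2 * |t| := by
  rw [triWave, (AddCircle.norm_coe_eq_abs_iff 1 one_ne_zero).2 (by simpa using ht)]

theorem exists_int_add (t : ℝ) : ∃ (n : ℤ) (r : ℝ), t = r + n ∧ |r| ≤ 1 / 2 :=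
  ⟨round t, t - round t, by ring, abs_sub_round t⟩

/-- Doubling the argument applies the tent map to the value. The tent map is written with
rectifiers, so that one hidden layer performs it. -/
theorem triWave_two_mul (t : ℝ) :
    triWave (2 * t) = 2 * max 0 (triWave t) - 4 * max 0 (triWave t - 1 / 2) := by
  obtain ⟨n, r, rfl, hr⟩ := exists_int_add t
  have e : 2 * (r + n) = 2 * r + ((2 * n : ℤ) : ℝ) := by push_cast; ring
  rw [e, triWave_add_int, triWave_add_int, triWave_of_abs_le hr,
    max_eq_right (by positivity : (0 : ℝ) ≤ 2 * |r|)]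
  by_cases h : |r| ≤ 1 / 4
  · have h2 : |2 * r| = 2 * |r| := by rw [abs_mul, abs_two]
    rw [triWave_of_abs_le (by rw [h2]; linarith), h2, max_eq_left (by linarith)]
    ring
  · push Not at h
    rw [max_eq_right (by linarith)]
    rcases le_total 0 r with h0 | h0
    · rw [abs_of_nonneg h0] at *
      rw [show 2 * r = (2 * r - 1) + ((1 : ℤ) : ℝ) by push_cast; ring, triWave_add_int,
        triWave_of_abs_le (by rw [abs_le]; constructor <;> linarith),
        abs_of_nonpos (by linarith)]
      ring
    · rw [abs_of_nonpos h0] at *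
      rw [show 2 * r = (2 * r + 1) + ((-1 : ℤ) : ℝ) by push_cast; ring, triWave_add_int,
        triWave_of_abs_le (by rw [abs_le]; constructor <;> linarith),
        abs_of_nonneg (by linarith)]
      ring

theorem triWave_of_mem_unit {s : ℝ} (h0 : 0 ≤ s) (h1 : s ≤ 1) :
    triWave s = 2 * max 0 s - 4 * max 0 (s - 1 / 2) := by
  rw [max_eq_right h0]
  rcases le_total s (1 / 2) with h | h
  · rw [triWave_of_abs_le (by rwa [abs_of_nonneg h0]), abs_of_nonneg h0,
      max_eq_left (by linarith)]
    ring
  · rw [show s = (s - 1) + ((1 : ℤ) : ℝ) by push_cast; ring, triWave_add_int,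
      triWave_of_abs_le (by rw [abs_le]; constructor <;> linarith),
      abs_of_nonpos (by linarith), max_eq_right (by push_cast; linarith)]
    push_cast
    ring

/-- The cosine on the right is even and of period `1` in `t`, so it depends only on the distance
from `t` to the nearest integer. -/
theorem cos_pi_mul_triWave (t : ℝ) :
    Real.cos (Real.pi * triWave t) = Real.cos (2 * Real.pi * t) := by
  obtain ⟨n, r, rfl, hr⟩ := exists_int_add t
  rw [triWave_add_int, triWave_of_abs_le hr,
    show 2 * Real.pi * (r + n) = 2 * Real.pi * r + n * (2 * Real.pi) by ring,
    Real.cos_add_int_mul_two_pi, ← Real.cos_abs (2 * Real.pi * r), abs_mul,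
    abs_of_pos Real.two_pi_pos]
  ring_nf

/-! ### Ramp waves and the cosine as their average. -/

/-- The positive part of the triangle wave above the level `τ`. -/
noncomputable def rampWave (τ t : ℝ) : ℝ := max 0 (triWave t - τ)

theorem rampWave_nonneg (τ t : ℝ) : 0 ≤ rampWave τ t := le_max_left _ _

theorem rampWave_le_one {τ : ℝ} (hτ : 0 ≤ τ) (t : ℝ) : rampWave τ t ≤ 1 :=
  max_le zero_le_one (by linarith [triWave_le_one t])

theorem rampWave_lipschitz (τ : ℝ) : LipschitzWith 2 (rampWave τ) := by
  have h : LipschitzWith 2 fun t => triWave t - τ :=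
    LipschitzWith.of_dist_le_mul fun x y => by
      simpa [Real.dist_eq] using triWave_lipschitz.dist_le_mul x y
  exact h.const_max 0

theorem continuous_rampWave_uncurry : Continuous (Function.uncurry rampWave) := by
  have := triWave_lipschitz.continuous
  unfold rampWave Function.uncurry
  fun_prop

theorem abs_deriv_rampWave_le (τ t : ℝ) : |deriv (rampWave τ) t| ≤ 2 := by
  simpa using norm_deriv_le_of_lipschitz (x₀ := t) (rampWave_lipschitz τ)

theorem measurable_deriv_rampWave :
    Measurable fun p : ℝ × ℝ => deriv (rampWave p.1) p.2 :=
  measurable_deriv_with_param continuous_rampWave_uncurry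

/-- Taylor's formula at `0` for `cos (π s)`, with the remainder in integral form; the linear term
vanishes. -/
theorem integral_cos_mul_sub (s : ℝ) :
    ∫ τ in (0 : ℝ)..s, Real.pi ^ 2 * Real.cos (Real.pi * τ) * (s - τ)
      = 1 - Real.cos (Real.pi * s) := by
  have hd : ∀ τ ∈ Set.uIcc 0 s, HasDerivAt
      (fun τ => Real.pi * (s - τ) * Real.sin (Real.pi * τ) - Real.cos (Real.pi * τ))
      (Real.pi ^ 2 * Real.cos (Real.pi * τ) * (s - τ)) τ := by
    intro τ _
    have h1 : HasDerivAt (fun τ => Real.pi * τ) Real.pi τ := by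
      simpa using (hasDerivAt_id τ).const_mul Real.pi
    have h2 := ((hasDerivAt_id τ).const_sub s).const_mul Real.pi
    refine ((h2.mul h1.sin).sub h1.cos).congr_deriv ?_
    simp only [id]
    ring
  rw [intervalIntegral.integral_eq_sub_of_hasDerivAt hd
    ((by fun_prop : Continuous _).intervalIntegrable _ _)]
  simp
  ring

theorem integral_cos_mul_rampWave (t : ℝ) :
    ∫ τ in (0 : ℝ)..1, (1 - Real.pi ^ 2 * Real.cos (Real.pi * τ) * rampWave τ t)
      = Real.cos (2 * Real.pi * t) := by
  have hc : Continuous fun τ => Real.pi ^ 2 * Real.cos (Real.pi * τ) * rampWave τ t := by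
    unfold rampWave; fun_prop
  rw [intervalIntegral.integral_sub (by simp) (hc.intervalIntegrable _ _),
    ← intervalIntegral.integral_add_adjacent_intervals (b := triWave t)
      (hc.intervalIntegrable _ _) (hc.intervalIntegrable _ _)]
  have h1 : ∫ τ in (0 : ℝ)..triWave t, Real.pi ^ 2 * Real.cos (Real.pi * τ) * rampWave τ t
      = 1 - Real.cos (Real.pi * triWave t) := by
    rw [← integral_cos_mul_sub]
    refine intervalIntegral.integral_congr fun τ hτ => ?_
    rw [Set.uIcc_of_le (triWave_nonneg t)] at hτ
    simp only [rampWave, max_eq_right (sub_nonneg.2 hτ.2)]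
  have h2 : ∫ τ in triWave t..1, Real.pi ^ 2 * Real.cos (Real.pi * τ) * rampWave τ t = 0 := by
    rw [← intervalIntegral.integral_zero (a := triWave t) (b := 1) (μ := volume)]
    refine intervalIntegral.integral_congr fun τ hτ => ?_
    rw [Set.uIcc_of_le (triWave_le_one t)] at hτ
    simp only [rampWave, max_eq_left (sub_nonpos.2 hτ.1), mul_zero]
  rw [h1, h2, cos_pi_mul_triWave]
  simp

theorem rampWave_add_int (τ t : ℝ) (n : ℤ) : rampWave τ (t + n) = rampWave τ t := by
  simp [rampWave, triWave_add_int]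

/-- At an extremum `deriv` is `0`, either by Fermat's theorem or by its default value at a kink, so
differentiability need not be discussed. -/
theorem deriv_rampWave_of_triWave_eq_zero {τ t : ℝ} (hτ : 0 ≤ τ) (ht : triWave t = 0) :
    deriv (rampWave τ) t = 0 := by
  refine IsLocalMin.deriv_eq_zero (Filter.Eventually.of_forall fun y => ?_)
  rw [rampWave, ht, max_eq_left (by linarith)]
  exact rampWave_nonneg _ _

theorem deriv_rampWave_of_triWave_eq_one {τ t : ℝ} (ht : triWave t = 1) :
    deriv (rampWave τ) t = 0 := by
  refine IsLocalMax.deriv_eq_zero (Filter.Eventually.of_forall fun y => ?_)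
  exact max_le_max le_rfl (by rw [ht]; linarith [triWave_le_one y])

theorem deriv_rampWave_of_lt {τ t : ℝ} (h : triWave t < τ) : deriv (rampWave τ) t = 0 := by
  have : rampWave τ =ᶠ[nhds t] fun _ => 0 := by
    filter_upwards [triWave_lipschitz.continuous.continuousAt.eventually_lt
      continuousAt_const h] with y hy
    exact max_eq_left (by linarith)
  rw [this.deriv_eq, deriv_const]

theorem deriv_rampWave_of_gt {τ t : ℝ} (h : τ < triWave t) :
    deriv (rampWave τ) t = deriv triWave t := by
  have : rampWave τ =ᶠ[nhds t] fun y => triWave y - τ := by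
    filter_upwards [continuousAt_const.eventually_lt
      triWave_lipschitz.continuous.continuousAt h] with y hy
    exact max_eq_right (by linarith)
  rw [this.deriv_eq, deriv_sub_const]

theorem sin_mul_deriv_triWave (t : ℝ) (h0 : triWave t ≠ 0) (h1 : triWave t ≠ 1) :
    Real.sin (Real.pi * triWave t) * deriv triWave t = 2 * Real.sin (2 * Real.pi * t) := by
  obtain ⟨n, r, rfl, hr⟩ := exists_int_add t
  rw [triWave_add_int, triWave_of_abs_le hr] at h0 h1
  have hr' : |r| < 1 / 2 := lt_of_le_of_ne hr fun h => h1 (by rw [h]; norm_num)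
  have hr0 : r ≠ 0 := fun h => h0 (by simp [h])
  have e1 : deriv triWave (r + n) = deriv triWave r := by
    rw [← deriv_comp_add_const]
    exact congrArg (fun f => deriv f r) (funext fun y => triWave_add_int y n)
  have e2 : triWave =ᶠ[nhds r] fun y => 2 * |y| := by
    filter_upwards [continuous_abs.continuousAt.eventually_lt continuousAt_const hr'] with y hy
    exact triWave_of_abs_le hy.le
  rw [e1, triWave_add_int, triWave_of_abs_le hr, e2.deriv_eq,
    show 2 * Real.pi * (r + n) = 2 * Real.pi * r + n * (2 * Real.pi) by ring,
    Real.sin_add_int_mul_two_pi]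
  rcases lt_or_gt_of_ne hr0 with h | h
  · rw [((hasDerivAt_abs_neg h).const_mul 2).deriv, abs_of_neg h,
      show Real.pi * (2 * -r) = -(2 * Real.pi * r) by ring, Real.sin_neg]
    ring
  · rw [((hasDerivAt_abs_pos h).const_mul 2).deriv, abs_of_pos h,
      show Real.pi * (2 * r) = 2 * Real.pi * r by ring]
    ring

theorem integral_cos_pi_mul (s : ℝ) :
    ∫ τ in (0 : ℝ)..s, Real.pi ^ 2 * Real.cos (Real.pi * τ) = Real.pi * Real.sin (Real.pi * s) := by
  have hd : ∀ τ ∈ Set.uIcc 0 s, HasDerivAt (fun τ => Real.pi * Real.sin (Real.pi * τ))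
      (Real.pi ^ 2 * Real.cos (Real.pi * τ)) τ := by
    intro τ _
    have h1 : HasDerivAt (fun τ => Real.pi * τ) Real.pi τ := by
      simpa using (hasDerivAt_id τ).const_mul Real.pi
    exact (h1.sin.const_mul Real.pi).congr_deriv (by ring)
  rw [intervalIntegral.integral_eq_sub_of_hasDerivAt hd
    ((by fun_prop : Continuous _).intervalIntegrable _ _)]
  simp

/-- This holds at every `t`. At the extrema of the triangle wave both sides vanish. Elsewhere the
derivative of the ramp is that of the triangle wave for levels below `triWave t` and `0` for levels
above, the single level `τ = triWave t` being negligible. -/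
theorem integral_cos_mul_deriv_rampWave (t : ℝ) :
    ∫ τ in (0 : ℝ)..1, -(Real.pi ^ 2 * Real.cos (Real.pi * τ) * deriv (rampWave τ) t)
      = -(2 * Real.pi * Real.sin (2 * Real.pi * t)) := by
  by_cases h0 : triWave t = 0
  · have hs : Real.sin (2 * Real.pi * t) = 0 := by
      rw [Real.sin_eq_zero_iff_cos_eq, ← cos_pi_mul_triWave, h0]; simp
    rw [hs, mul_zero, neg_zero]
    refine (intervalIntegral.integral_congr (g := fun _ => 0) fun τ hτ => ?_).trans (by simp)
    rw [Set.uIcc_of_le zero_le_one] at hτ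
    simp [deriv_rampWave_of_triWave_eq_zero hτ.1 h0]
  by_cases h1 : triWave t = 1
  · have hs : Real.sin (2 * Real.pi * t) = 0 := by
      rw [Real.sin_eq_zero_iff_cos_eq, ← cos_pi_mul_triWave, h1]; simp
    simp [deriv_rampWave_of_triWave_eq_one h1, hs]
  have e : ∀ τ ≠ triWave t, -(Real.pi ^ 2 * Real.cos (Real.pi * τ) * deriv (rampWave τ) t)
      = {τ | τ ≤ triWave t}.indicator
          (fun τ => -(Real.pi ^ 2 * Real.cos (Real.pi * τ) * deriv triWave t)) τ := by
    intro τ hτ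
    rcases lt_or_gt_of_ne hτ with h | h
    · rw [Set.indicator_of_mem (show τ ∈ {τ | τ ≤ triWave t} from h.le), deriv_rampWave_of_gt h]
    · rw [Set.indicator_of_notMem (by simpa using h), deriv_rampWave_of_lt h]; simp
  have hne : ∀ᵐ τ : ℝ, τ ≠ triWave t := by
    simp [ae_iff]
  rw [intervalIntegral.integral_congr_ae (hne.mono fun τ hτ _ => e τ hτ),
    intervalIntegral.integral_indicator ⟨triWave_nonneg t, triWave_le_one t⟩,
    intervalIntegral.integral_neg, intervalIntegral.integral_mul_const, integral_cos_pi_mul,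
    mul_assoc, sin_mul_deriv_triWave t h0 h1]
  ring

/-! ### Building networks layer by layer -/

theorem hiddenLayer_congr {d N : ℕ} (W₀ : Matrix (Fin N) (Fin d) ℝ)
    {W W' : ℕ → Matrix (Fin N) (Fin N) ℝ} {b b' : ℕ → Fin N → ℝ} (x : EuclideanSpace ℝ (Fin d)) :
    ∀ L : ℕ, (∀ l < L, W l = W' l) → (∀ l ≤ L, b l = b' l) →
      hiddenLayer W₀ W b x L = hiddenLayer W₀ W' b' x L
  | 0, _, hb => by simp [hiddenLayer, hb 0 le_rfl]
  | L + 1, hW, hb => by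
    rw [hiddenLayer, hiddenLayer, hW L (Nat.lt_succ_self L), hb (L + 1) le_rfl,
      hiddenLayer_congr W₀ x L (fun l hl => hW l (by omega)) (fun l hl => hb l (by omega))]

/-- A single network with `L + 1` hidden layers of width `N` computes all functions of `A` on `Q`,
each with its own output weights. -/
def ComputedBy {d : ℕ} (Q : Set (EuclideanSpace ℝ (Fin d))) (L N : ℕ)
    (A : Set (EuclideanSpace ℝ (Fin d) → ℝ)) : Prop :=
  ∃ (W₀ : Matrix (Fin N) (Fin d) ℝ) (W : ℕ → Matrix (Fin N) (Fin N) ℝ) (b : ℕ → Fin N → ℝ),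
    ∀ h ∈ A, ∃ v : Fin N → ℝ, ∀ x ∈ Q, h x = ∑ i, v i * hiddenLayer W₀ W b x L i

/-- The linear combinations on `Q` of the rectified functions `G i`. -/
def reluSpan {d N : ℕ} (Q : Set (EuclideanSpace ℝ (Fin d)))
    (G : Fin N → EuclideanSpace ℝ (Fin d) → ℝ) : Set (EuclideanSpace ℝ (Fin d) → ℝ) :=
  {h | ∃ v : Fin N → ℝ, ∀ x ∈ Q, h x = ∑ i, v i * max 0 (G i x)}

theorem ComputedBy.mono {d L N : ℕ} {Q : Set (EuclideanSpace ℝ (Fin d))}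
    {A B : Set (EuclideanSpace ℝ (Fin d) → ℝ)} (hA : ComputedBy Q L N A) (h : B ⊆ A) :
    ComputedBy Q L N B := by
  obtain ⟨W₀, W, b, hW⟩ := hA
  exact ⟨W₀, W, b, fun g hg => hW g (h hg)⟩

theorem computedBy_zero {d N : ℕ} {Q : Set (EuclideanSpace ℝ (Fin d))}
    {G : Fin N → EuclideanSpace ℝ (Fin d) → ℝ}
    (hG : ∀ i, ∃ (w : Fin d → ℝ) (c : ℝ), ∀ x ∈ Q, G i x = ∑ j, w j * x j + c) :
    ComputedBy Q 0 N (reluSpan Q G) := by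
  choose w c hwc using hG
  refine ⟨Matrix.of w, 0, fun _ => c, fun h ⟨v, hv⟩ => ⟨v, fun x hx => ?_⟩⟩
  rw [hv x hx]
  refine Finset.sum_congr rfl fun i _ => ?_
  rw [hwc i x hx]
  simp [hiddenLayer, Matrix.mulVec, dotProduct]

theorem ComputedBy.succ {d L N : ℕ} {Q : Set (EuclideanSpace ℝ (Fin d))}
    {A : Set (EuclideanSpace ℝ (Fin d) → ℝ)} (hA : ComputedBy Q L N A)
    {G : Fin N → EuclideanSpace ℝ (Fin d) → ℝ} (hG : ∀ i, G i ∈ A) :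
    ComputedBy Q (L + 1) N (reluSpan Q G) := by
  obtain ⟨W₀, W, b, hW⟩ := hA
  choose v hv using fun i => hW (G i) (hG i)
  -- The new bias is zero: each `G i` is already a linear readout of the previous layer, constants
  -- included.
  refine ⟨W₀, Function.update W L (Matrix.of v), Function.update b (L + 1) 0,
    fun h ⟨w, hw⟩ => ⟨w, fun x hx => ?_⟩⟩
  rw [hw x hx]
  refine Finset.sum_congr rfl fun i _ => ?_
  rw [hv i x hx, hiddenLayer, hiddenLayer_congr (W := Function.update W L (Matrix.of v))
    (b := Function.update b (L + 1) 0) (W' := W) (b' := b) W₀ x L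
    (fun l hl => Function.update_of_ne hl.ne _ _)
    (fun l hl => Function.update_of_ne (Nat.lt_succ_of_le hl).ne _ _)]
  simp [Matrix.mulVec, dotProduct]

/-- The affine combinations on `Q` of the coordinates, an accumulator and two work registers. -/
def registerSpan {d : ℕ} (Q : Set (EuclideanSpace ℝ (Fin d)))
    (acc p q : EuclideanSpace ℝ (Fin d) → ℝ) : Set (EuclideanSpace ℝ (Fin d) → ℝ) :=
  {h | ∃ (α : Fin d → ℝ) (e a b c : ℝ),
    ∀ x ∈ Q, h x = ∑ j, α j * x j + (e + a * acc x + b * p x + c * q x)}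

/-- After `L` hidden layers of width `d + 4`, a network gives access on `Q` to the coordinates, the
constants, an accumulator `acc` and two work registers `p`, `q`. -/
def NetworkState {d : ℕ} (Q : Set (EuclideanSpace ℝ (Fin d))) (L : ℕ)
    (acc p q : EuclideanSpace ℝ (Fin d) → ℝ) : Prop :=
  match L with
  | 0 => ∀ h ∈ registerSpan Q acc p q, ∃ (w : Fin d → ℝ) (c : ℝ),
      ∀ x ∈ Q, h x = ∑ j, w j * x j + c
  | L + 1 => ComputedBy Q L (d + 4) (registerSpan Q acc p q)

theorem networkState_zero {d : ℕ} (Q : Set (EuclideanSpace ℝ (Fin d))) (B : ℝ) :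
    NetworkState Q 0 (fun _ => B) 0 0 := by
  rintro h ⟨α, e, a, b, c, hh⟩
  exact ⟨α, e + a * B, fun x hx => by rw [hh x hx]; simp⟩

theorem NetworkState.succ {d L : ℕ} {Q : Set (EuclideanSpace ℝ (Fin d))}
    (hQ : ∀ x ∈ Q, ∀ i, 0 ≤ x i) {acc p q acc' g₁ g₂ : EuclideanSpace ℝ (Fin d) → ℝ}
    (h : NetworkState Q L acc p q) (hacc : acc' ∈ registerSpan Q acc p q)
    (h₁ : g₁ ∈ registerSpan Q acc p q) (h₂ : g₂ ∈ registerSpan Q acc p q)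
    (hpos : ∀ x ∈ Q, 0 ≤ acc' x) :
    NetworkState Q (L + 1) acc' (fun x => max 0 (g₁ x)) (fun x => max 0 (g₂ x)) := by
  -- This is the budget of `d + 4` neurons. The coordinates, the constant and the accumulator are
  -- nonnegative on `Q` and pass through the rectifier unchanged; only the last two neurons compute.
  -- The constant `1` needs a neuron because the readout has no bias.
  let G : Fin (d + 4) → EuclideanSpace ℝ (Fin d) → ℝ :=
    Fin.append (fun j x => x j) ![fun _ => 1, acc', g₁, g₂]
  have hG : ∀ i, G i ∈ registerSpan Q acc p q := by
    intro i
    refine Fin.addCases (fun j => ?_) (fun j => ?_) i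
    · simp only [G, Fin.append_left]
      exact ⟨Pi.single j 1, 0, 0, 0, 0, fun x _ => by simp [Pi.single_apply]⟩
    · simp only [G, Fin.append_right]
      fin_cases j
      · exact ⟨0, 1, 0, 0, 0, fun x _ => by simp⟩
      · exact hacc
      · exact h₁
      · exact h₂
  have hsub : registerSpan Q acc' (fun x => max 0 (g₁ x)) (fun x => max 0 (g₂ x))
      ⊆ reluSpan Q G := by
    rintro h ⟨α, e, a, b, c, hh⟩
    refine ⟨Fin.append α ![e, a, b, c], fun x hx => ?_⟩
    rw [hh x hx, Fin.sum_univ_add, Fin.sum_univ_four]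
    simp [G, hpos x hx, hQ x hx]
  cases L with
  | zero => exact (computedBy_zero fun i => h _ (hG i)).mono hsub
  | succ L => exact (ComputedBy.succ h hG).mono hsub

theorem NetworkState.exists_network {d L : ℕ} {Q : Set (EuclideanSpace ℝ (Fin d))}
    {acc p q h : EuclideanSpace ℝ (Fin d) → ℝ} (hs : NetworkState Q (L + 1) acc p q)
    (hh : h ∈ registerSpan Q acc p q) :
    ∃ F, IsReLUNetwork (L + 1) (d + 4) F ∧ ∀ x ∈ Q, F x = h x := by
  obtain ⟨W₀, W, b, hW⟩ := hs
  obtain ⟨v, hv⟩ := hW h hh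
  exact ⟨fun x => ∑ i, v i * hiddenLayer W₀ W b x L i, ⟨by omega, W₀, W, b, v, fun x => rfl⟩,
    fun x hx => (hv x hx).symm⟩

/-- Iterated tent maps: `K + 1` layers turn an affine function with values in `[0, 1]` into the
triangle wave of the function scaled by `2 ^ K`, keeping the accumulator. -/
theorem NetworkState.exists_triWave {d L : ℕ} {Q : Set (EuclideanSpace ℝ (Fin d))}
    (hQ : ∀ x ∈ Q, ∀ i, 0 ≤ x i) {acc p q acc' s : EuclideanSpace ℝ (Fin d) → ℝ}
    (h : NetworkState Q L acc p q) (hacc : acc' ∈ registerSpan Q acc p q)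
    (hpos : ∀ x ∈ Q, 0 ≤ acc' x) (α : Fin d → ℝ) (e : ℝ)
    (hs : ∀ x ∈ Q, s x = ∑ j, α j * x j + e) (hs01 : ∀ x ∈ Q, s x ∈ Set.Icc (0 : ℝ) 1) (K : ℕ) :
    ∃ p' q', NetworkState Q (L + (K + 1)) acc' p' q' ∧
      ∀ x ∈ Q, 2 * p' x - 4 * q' x = triWave (2 ^ K * s x) := by
  induction K with
  | zero =>
    refine ⟨_, _, h.succ hQ (g₁ := s) (g₂ := fun x => s x - 1 / 2) hacc
      ⟨α, e, 0, 0, 0, fun x hx => by simp [hs x hx]⟩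
      ⟨α, e - 1 / 2, 0, 0, 0, fun x hx => by simp [hs x hx]; ring⟩ hpos, fun x hx => ?_⟩
    rw [pow_zero, one_mul, triWave_of_mem_unit (hs01 x hx).1 (hs01 x hx).2]
  | succ K ih =>
    obtain ⟨p', q', hst, hpq⟩ := ih
    refine ⟨_, _, hst.succ hQ (acc' := acc') (g₁ := fun x => 2 * p' x - 4 * q' x)
      (g₂ := fun x => 2 * p' x - 4 * q' x - 1 / 2)
      ⟨0, 0, 1, 0, 0, fun x hx => by simp⟩ ⟨0, 0, 0, 2, -4, fun x hx => by simp; ring⟩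
      ⟨0, -1 / 2, 0, 2, -4, fun x hx => by simp; ring⟩ hpos, fun x hx => ?_⟩
    simp only [hpq x hx]
    rw [pow_succ', mul_assoc, triWave_two_mul]

/-- On the unit cube, `K + 2` further layers compute `rampWave τ` of an affine function of slope at
most `2 ^ K - 1`. -/
theorem NetworkState.exists_rampWave {d L : ℕ} {acc p q acc' : EuclideanSpace ℝ (Fin d) → ℝ}
    {Q : Set (EuclideanSpace ℝ (Fin d))} (hQ : ∀ x ∈ Q, ∀ i, x i ∈ Set.Icc (0 : ℝ) 1)
    (h : NetworkState Q L acc p q) (hacc : acc' ∈ registerSpan Q acc p q)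
    (hpos : ∀ x ∈ Q, 0 ≤ acc' x) (ξ : EuclideanSpace ℝ (Fin d)) (c τ : ℝ) {K : ℕ}
    (hK : 1 + l1Norm ξ ≤ 2 ^ K) :
    ∃ p' q', NetworkState Q (L + (K + 2)) acc' p' q' ∧
      ∀ x ∈ Q, p' x = rampWave τ (∑ j, ξ j * x j + c) := by
  -- On the cube `ξ·x` ranges over an interval of length `|ξ|₁` starting at `-∑ max 0 (-ξ j)`.
  -- Subtracting `n` brings the phase into `[0, 1 + |ξ|₁]`, the extra `1` coming from the floor, and
  -- an integer shift does not change the wave.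
  let n : ℤ := ⌊c - ∑ j, max 0 (-ξ j)⌋
  have hQ0 : ∀ x ∈ Q, ∀ i, 0 ≤ x i := fun x hx i => (hQ x hx i).1
  have hKpos : (0 : ℝ) < 2 ^ K := by positivity
  have hlow : ∀ x ∈ Q, -∑ j, max 0 (-ξ j) ≤ ∑ j, ξ j * x j := by
    intro x hx
    rw [← Finset.sum_neg_distrib]
    refine Finset.sum_le_sum fun j _ => ?_
    have := hQ x hx j
    rcases le_total 0 (ξ j) with h | h
    · rw [max_eq_left (by linarith)]
      simpa using mul_nonneg h this.1
    · rw [max_eq_right (by linarith)]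
      nlinarith [this.2]
  have hup : ∀ x ∈ Q, ∑ j, ξ j * x j ≤ l1Norm ξ - ∑ j, max 0 (-ξ j) := by
    intro x hx
    rw [l1Norm, ← Finset.sum_sub_distrib]
    refine Finset.sum_le_sum fun j _ => ?_
    have := hQ x hx j
    rcases le_total 0 (ξ j) with h | h
    · rw [max_eq_left (by linarith), abs_of_nonneg h]
      nlinarith [this.2]
    · rw [max_eq_right (by linarith), abs_of_nonpos h]
      nlinarith [this.1]
  have hn1 := Int.floor_le (c - ∑ j, max 0 (-ξ j))
  have hn2 := Int.lt_floor_add_one (c - ∑ j, max 0 (-ξ j))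
  obtain ⟨p', q', hst, hpq⟩ := h.exists_triWave hQ0 hacc hpos
    (s := fun x => (∑ j, ξ j * x j + c - n) / 2 ^ K) (fun j => ξ j / 2 ^ K) ((c - n) / 2 ^ K)
    (fun x hx => by
      simp only [div_mul_eq_mul_div, ← Finset.sum_div]
      ring)
    (fun x hx => ⟨div_nonneg (by linarith [hlow x hx]) hKpos.le,
      (div_le_one hKpos).2 (by linarith [hup x hx])⟩) K
  refine ⟨_, _, hst.succ hQ0 (acc' := acc') (g₁ := fun x => 2 * p' x - 4 * q' x - τ) (g₂ := 0)
    ⟨0, 0, 1, 0, 0, fun x hx => by simp⟩ ⟨0, -τ, 0, 2, -4, fun x hx => by simp; ring⟩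
    ⟨0, 0, 0, 0, 0, fun x hx => by simp⟩ hpos, fun x hx => ?_⟩
  simp only [hpq x hx]
  rw [mul_div_cancel₀ _ hKpos.ne', ← rampWave_add_int τ _ (-n)]
  simp [rampWave, sub_eq_add_neg]

/-- Linear combinations of ramped triangle waves of affine functions are exactly representable on
the unit cube, up to a constant that can be prescribed. -/
theorem exists_network_sum_rampWave {d : ℕ} {Q : Set (EuclideanSpace ℝ (Fin d))}
    (hQ : ∀ x ∈ Q, ∀ i, x i ∈ Set.Icc (0 : ℝ) 1) (n : ℕ)
    (ξ : Fin (n + 1) → EuclideanSpace ℝ (Fin d)) (c τ a : Fin (n + 1) → ℝ) (hτ : ∀ i, 0 ≤ τ i) (K : Fin (n + 1) → ℕ)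
    (hK : ∀ i, 1 + l1Norm (ξ i) ≤ 2 ^ K i) (e : ℝ) :
    ∃ F, IsReLUNetwork (∑ i, (K i + 2)) (d + 4) F ∧
      ∀ x ∈ Q, F x = ∑ i, a i * rampWave (τ i) (∑ j, ξ i j * x j + c i) + e := by
  -- Each term satisfies `|R i x| ≤ |a i|`, so starting the accumulator at `B` keeps all partial
  -- sums nonnegative and the rectifier leaves them intact. The output weights remove `B` at the
  -- end.
  let B : ℝ := ∑ i, |a i|
  let R : Fin (n + 1) → EuclideanSpace ℝ (Fin d) → ℝ :=
    fun i x => a i * rampWave (τ i) (∑ j, ξ i j * x j + c i)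
  have hR : ∀ i x, -|a i| ≤ R i x := fun i x => by
    have h0 := rampWave_nonneg (τ i) (∑ j, ξ i j * x j + c i)
    have h1 := rampWave_le_one (hτ i) (∑ j, ξ i j * x j + c i)
    have h2 : |R i x| ≤ |a i| := by
      simp only [R, abs_mul, abs_of_nonneg h0]
      exact mul_le_of_le_one_right (abs_nonneg _) h1
    exact (abs_le.1 h2).1
  have hpos : ∀ (k : Finset (Fin (n + 1))) x, 0 ≤ B + ∑ i ∈ k, R i x := fun k x => by
    have h1 : -∑ i ∈ k, |a i| ≤ ∑ i ∈ k, R i x := by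
      rw [← Finset.sum_neg_distrib]
      exact Finset.sum_le_sum fun i _ => hR i x
    have h2 : ∑ i ∈ k, |a i| ≤ B :=
      Finset.sum_le_univ_sum_of_nonneg fun i => abs_nonneg _
    linarith
  -- After block `k` its ramp is still in the register `p`. Adding it to the accumulator is left to
  -- the first layer of the next block, or to the output layer, and so costs no layer of its own.
  have key : ∀ k : ℕ, (hk : k < n + 1) → ∃ acc p q,
      NetworkState Q (∑ i ∈ Finset.univ.filter (fun i : Fin (n + 1) => i.1 < k + 1), (K i + 2))
        acc p q ∧ ∀ x ∈ Q, acc x + a ⟨k, hk⟩ * p x =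
          B + ∑ i ∈ Finset.univ.filter (fun i : Fin (n + 1) => i.1 < k + 1), R i x := by
    have hfil : ∀ (k : ℕ) (hk : k < n + 1),
        Finset.univ.filter (fun i : Fin (n + 1) => i.1 < k + 1)
          = insert ⟨k, hk⟩ (Finset.univ.filter (fun i : Fin (n + 1) => i.1 < k)) := by
      intro k hk
      ext i
      simp only [Finset.mem_filter, Finset.mem_univ, true_and, Finset.mem_insert, Fin.ext_iff]
      omega
    have hstep : ∀ (k : ℕ) (hk : k < n + 1) (L : ℕ) (acc p q : EuclideanSpace ℝ (Fin d) → ℝ),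
        NetworkState Q L acc p q →
        (fun x => B + ∑ i ∈ Finset.univ.filter (fun i : Fin (n + 1) => i.1 < k), R i x)
          ∈ registerSpan Q acc p q →
        L = ∑ i ∈ Finset.univ.filter (fun i : Fin (n + 1) => i.1 < k), (K i + 2) →
        ∃ acc p q,
          NetworkState Q (∑ i ∈ Finset.univ.filter (fun i : Fin (n + 1) => i.1 < k + 1), (K i + 2))
            acc p q ∧ ∀ x ∈ Q, acc x + a ⟨k, hk⟩ * p x =
              B + ∑ i ∈ Finset.univ.filter (fun i : Fin (n + 1) => i.1 < k + 1), R i x := by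
      intro k hk L acc p q hst hmem hL
      obtain ⟨p', q', hst', hp'⟩ := hst.exists_rampWave hQ hmem (fun x _ => hpos _ x)
        (ξ ⟨k, hk⟩) (c ⟨k, hk⟩) (τ ⟨k, hk⟩) (hK ⟨k, hk⟩)
      rw [hfil k hk, Finset.sum_insert (by simp), add_comm (K ⟨k, hk⟩ + 2), ← hL]
      refine ⟨_, p', q', hst', fun x hx => ?_⟩
      rw [Finset.sum_insert (by simp), hp' x hx]
      simp only [R]
      ring
    intro k
    induction k with
    | zero =>
      intro hk
      exact hstep 0 hk 0 _ _ _ (networkState_zero Q B)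
        ⟨0, 0, 1, 0, 0, fun x hx => by simp⟩ (by simp)
    | succ k ih =>
      intro hk
      obtain ⟨acc, p, q, hst, hacc⟩ := ih (by omega)
      exact hstep (k + 1) hk _ acc p q hst
        ⟨0, 0, 1, a ⟨k, by omega⟩, 0, fun x hx =>
          (hacc x hx).symm.trans (by simp)⟩ rfl
  obtain ⟨acc, p, q, hst, hacc⟩ := key n (by omega)
  have hall : Finset.univ.filter (fun i : Fin (n + 1) => i.1 < n + 1) = Finset.univ := by
    ext i; simpa using Nat.le_of_lt_succ i.2
  rw [hall] at hst hacc
  obtain ⟨L, hL⟩ : ∃ L, ∑ i, (K i + 2) = L + 1 := by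
    refine Nat.exists_eq_succ_of_ne_zero ?_
    rw [Fin.sum_univ_succ]
    omega
  rw [hL] at hst ⊢
  obtain ⟨F, hF, hFQ⟩ := hst.exists_network
    (h := fun x => ∑ i, a i * rampWave (τ i) (∑ j, ξ i j * x j + c i) + e)
    ⟨0, e - B, 1, a ⟨n, by omega⟩, 0, fun x hx => by
      have := hacc x hx
      simp only [R] at this
      simp only [Pi.zero_apply, zero_mul, Finset.sum_const_zero]
      linarith⟩
  exact ⟨F, hF, hFQ⟩

/-! ### Networks are Lipschitz -/

theorem exists_lipschitzWith_sum_mul {α ι : Type*} [PseudoMetricSpace α] [Fintype ι] (v : ι → ℝ)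
    {h : ι → α → ℝ} (hh : ∀ i, ∃ C, LipschitzWith C (h i)) (c : ℝ) :
    ∃ C, LipschitzWith C fun x => ∑ i, v i * h i x + c := by
  choose C hC using hh
  refine ⟨∑ i, ‖v i‖₊ * C i, LipschitzWith.of_dist_le_mul fun x y => ?_⟩
  rw [Real.dist_eq, add_sub_add_right_eq_sub, ← Finset.sum_sub_distrib]
  refine (Finset.abs_sum_le_sum_abs _ _).trans ?_
  push_cast
  rw [Finset.sum_mul]
  refine Finset.sum_le_sum fun i _ => ?_
  rw [← mul_sub, abs_mul, mul_assoc, ← Real.dist_eq, Real.norm_eq_abs]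
  exact mul_le_mul_of_nonneg_left ((hC i).dist_le_mul x y) (abs_nonneg _)

theorem exists_lipschitzWith_hiddenLayer {d N : ℕ} (W₀ : Matrix (Fin N) (Fin d) ℝ)
    (W : ℕ → Matrix (Fin N) (Fin N) ℝ) (b : ℕ → Fin N → ℝ) (L : ℕ) :
    ∀ i, ∃ C, LipschitzWith C fun x => hiddenLayer W₀ W b x L i := by
  induction L with
  | zero =>
    intro i
    obtain ⟨C, hC⟩ := exists_lipschitzWith_sum_mul (W₀ i)
      (h := fun j (x : EuclideanSpace ℝ (Fin d)) => x j)
      (fun j => ⟨_, (EuclideanSpace.proj (𝕜 := ℝ) j).lipschitz⟩) (b 0 i)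
    exact ⟨C, hC.const_max 0⟩
  | succ L ih =>
    intro i
    obtain ⟨C, hC⟩ := exists_lipschitzWith_sum_mul (W L i) ih (b (L + 1) i)
    exact ⟨C, hC.const_max 0⟩

/-- The explicit formula for the network is available only on the cube, but `h1Norm` asks for weak
derivatives on the whole space; the Lipschitz property supplies them. -/
theorem IsReLUNetwork.exists_lipschitzWith {d L N : ℕ} {F : EuclideanSpace ℝ (Fin d) → ℝ}
    (hF : IsReLUNetwork L N F) : ∃ C, LipschitzWith C F := by
  obtain ⟨-, W₀, W, b, v, h⟩ := hF
  obtain ⟨C, hC⟩ := exists_lipschitzWith_sum_mul v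
    (exists_lipschitzWith_hiddenLayer W₀ W b (L - 1)) 0
  exact ⟨C, by simpa only [add_zero, ← h] using hC⟩

/-! ### Sampling one point at a time -/

/-- Adding one centred sample to an accumulated error `D`: for each `x` the cross term has mean
zero, and the variance is at most the second moment. -/
theorem integral_integral_sq_add_sub_mean_le {S X : Type*} [MeasurableSpace S] [MeasurableSpace X]
    {P : Measure S} [IsProbabilityMeasure P] {ν : Measure X} [IsFiniteMeasure ν]
    {Φ : S → X → ℝ} (hΦ : Measurable (Function.uncurry Φ)) {C : ℝ} (hC : ∀ s x, |Φ s x| ≤ C)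
    {D : X → ℝ} (hD : Measurable D) {C' : ℝ} (hC' : ∀ x, |D x| ≤ C') :
    Integrable (fun s => ∫ x, (D x + (Φ s x - ∫ s', Φ s' x ∂P)) ^ 2 ∂ν) P ∧
      ∫ s, ∫ x, (D x + (Φ s x - ∫ s', Φ s' x ∂P)) ^ 2 ∂ν ∂P
        ≤ ∫ x, D x ^ 2 ∂ν + ∫ s, ∫ x, Φ s x ^ 2 ∂ν ∂P := by
  set g : X → ℝ := fun x => ∫ s', Φ s' x ∂P with hg
  have hΦs : ∀ x, Measurable fun s => Φ s x := fun x => hΦ.comp measurable_prodMk_right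
  have hgm : Measurable g :=
    hΦ.stronglyMeasurable.integral_prod_left.measurable
  have hgC : ∀ x, |g x| ≤ C := fun x => by
    have := norm_integral_le_of_norm_le_const (μ := P) (f := fun s => Φ s x)
      (Filter.Eventually.of_forall fun s => hC s x)
    simpa using this
  have hbig : Integrable (Function.uncurry fun s x => (D x + (Φ s x - g x)) ^ 2) (P.prod ν) := by
    refine Integrable.of_bound (Measurable.aestronglyMeasurable ?_) ((C' + (C + C)) ^ 2)
      (Filter.Eventually.of_forall fun z => ?_)
    · exact ((hD.comp measurable_snd).add (hΦ.sub (hgm.comp measurable_snd))).pow_const 2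
    · simp only [Function.uncurry, Real.norm_eq_abs, abs_pow]
      refine pow_le_pow_left₀ (abs_nonneg _) ?_ 2
      refine (abs_add_le _ _).trans (add_le_add (hC' _) ?_)
      exact (abs_sub _ _).trans (add_le_add (hC _ _) (hgC _))
  have hsq : Integrable (Function.uncurry fun s x => Φ s x ^ 2) (P.prod ν) := by
    refine Integrable.of_bound (hΦ.pow_const 2).aestronglyMeasurable (C ^ 2)
      (Filter.Eventually.of_forall fun z => ?_)
    simp only [Function.uncurry, Real.norm_eq_abs, abs_pow]
    exact pow_le_pow_left₀ (abs_nonneg _) (hC _ _) 2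
  have hDsq : Integrable (fun x => D x ^ 2) ν := by
    refine Integrable.of_bound (hD.pow_const 2).aestronglyMeasurable (C' ^ 2)
      (Filter.Eventually.of_forall fun x => ?_)
    simp only [Real.norm_eq_abs, abs_pow]
    exact pow_le_pow_left₀ (abs_nonneg _) (hC' _) 2
  refine ⟨hbig.integral_prod_left, ?_⟩
  rw [integral_integral_swap hbig, integral_integral_swap hsq]
  refine le_of_le_of_eq ?_ (integral_add hDsq hsq.integral_prod_right)
  refine integral_mono hbig.integral_prod_right (hDsq.add hsq.integral_prod_right) fun x => ?_
  have h1 : Integrable (fun s => Φ s x) P :=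
    Integrable.of_bound (hΦs x).aestronglyMeasurable C (Filter.Eventually.of_forall fun s => hC s x)
  have h2 : Integrable (fun s => Φ s x ^ 2) P := by
    refine Integrable.of_bound ((hΦs x).pow_const 2).aestronglyMeasurable (C ^ 2)
      (Filter.Eventually.of_forall fun s => ?_)
    simp only [Real.norm_eq_abs, abs_pow]
    exact pow_le_pow_left₀ (abs_nonneg _) (hC _ _) 2
  have e : ∀ s, (D x + (Φ s x - g x)) ^ 2
      = (D x - g x) ^ 2 + 2 * (D x - g x) * Φ s x + Φ s x ^ 2 := fun s => by ring
  have hint : ∫ s, (D x + (Φ s x - g x)) ^ 2 ∂P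
      = (D x - g x) ^ 2 + 2 * (D x - g x) * g x + ∫ s, Φ s x ^ 2 ∂P := by
    simp only [e]
    have h3 : Integrable (fun s => (D x - g x) ^ 2 + 2 * (D x - g x) * Φ s x) P :=
      (integrable_const _).add (h1.const_mul _)
    rw [integral_add h3 h2, integral_add (integrable_const _) (h1.const_mul _), integral_const_mul]
    simp [hg]
  change ∫ s, (D x + (Φ s x - g x)) ^ 2 ∂P ≤ D x ^ 2 + ∫ s, Φ s x ^ 2 ∂P
  rw [hint]
  nlinarith [sq_nonneg (g x)]

/-- Sampling with a cost: `n` points can be chosen so that a weighted sum of the squared error of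
the empirical sum and of the total cost is at most its mean bound. -/
theorem exists_sample_sq_error_add_cost_le {S X ι : Type*} [MeasurableSpace S] [MeasurableSpace X]
    [Fintype ι] {P : Measure S} [IsProbabilityMeasure P] {ν : Measure X} [IsFiniteMeasure ν]
    {Φ : ι → S → X → ℝ} (hΦ : ∀ j, Measurable (Function.uncurry (Φ j))) {V : ℝ}
    (hV : ∀ s x, ∑ j, Φ j s x ^ 2 ≤ V) {κ : S → ℝ} (hκ : Integrable κ P)
    {a b : ℝ} (ha : 0 ≤ a) (n : ℕ) :
    ∃ s : Fin n → S, a * ∑ j, ∫ x, (∑ i, (Φ j (s i) x - ∫ s', Φ j s' x ∂P)) ^ 2 ∂ν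
      + b * ∑ i, κ (s i) ≤ n * (a * (V * ν.real Set.univ) + b * ∫ s, κ s ∂P) := by
  have hC : ∀ j s x, |Φ j s x| ≤ √V := fun j s x => by
    refine Real.abs_le_sqrt (le_trans ?_ (hV s x))
    exact Finset.single_le_sum (f := fun j => Φ j s x ^ 2) (fun j _ => sq_nonneg _)
      (Finset.mem_univ j)
  have hgm : ∀ j, Measurable fun x => ∫ s', Φ j s' x ∂P := fun j =>
    (hΦ j).stronglyMeasurable.integral_prod_left.measurable
  have hgC : ∀ j x, |∫ s', Φ j s' x ∂P| ≤ √V := fun j x => by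
    have := norm_integral_le_of_norm_le_const (μ := P) (f := fun s => Φ j s x)
      (Filter.Eventually.of_forall fun s => hC j s x)
    simpa using this
  have hsq : ∀ j, Integrable (Function.uncurry fun s x => Φ j s x ^ 2) (P.prod ν) := fun j => by
    refine Integrable.of_bound ((hΦ j).pow_const 2).aestronglyMeasurable (√V ^ 2)
      (Filter.Eventually.of_forall fun z => ?_)
    simp only [Function.uncurry, Real.norm_eq_abs, abs_pow]
    exact pow_le_pow_left₀ (abs_nonneg _) (hC _ _ _) 2
  have hVint : ∑ j, ∫ s, ∫ x, Φ j s x ^ 2 ∂ν ∂P ≤ V * ν.real Set.univ := by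
    have e : ∑ j, ∫ s, ∫ x, Φ j s x ^ 2 ∂ν ∂P = ∫ z, ∑ j, Φ j z.1 z.2 ^ 2 ∂(P.prod ν) := by
      refine Eq.trans ?_ (integral_finsetSum _ fun j _ => hsq j).symm
      exact Finset.sum_congr rfl fun j _ => integral_integral (hsq j)
    rw [e]
    refine (integral_mono (integrable_finsetSum _ fun j _ => hsq j) (integrable_const V)
      fun z => hV z.1 z.2).trans_eq ?_
    rw [integral_const, smul_eq_mul, mul_comm, ← Set.univ_prod_univ, measureReal_prod_prod]
    simp
  induction n with
  | zero => exact ⟨Fin.elim0, by simp⟩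
  | succ n ih =>
    obtain ⟨s, hs⟩ := ih
    let D : ι → X → ℝ := fun j x => ∑ i, (Φ j (s i) x - ∫ s', Φ j s' x ∂P)
    have hD : ∀ j, Measurable (D j) := fun j =>
      Finset.measurable_fun_sum _ fun i _ =>
        ((hΦ j).comp measurable_prodMk_left).sub (hgm j)
    have hDC : ∀ j x, |D j x| ≤ n * (√V + √V) := fun j x => by
      refine (Finset.abs_sum_le_sum_abs _ _).trans ?_
      refine (Finset.sum_le_sum fun i _ =>
        (abs_sub _ _).trans (add_le_add (hC j (s i) x) (hgC j x))).trans_eq ?_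
      simp [mul_add]
    have hstep := fun j => integral_integral_sq_add_sub_mean_le (P := P) (ν := ν) (hΦ j) (hC j)
      (hD j) (hDC j)
    have hint1 : Integrable (fun t => a * ∑ j, ∫ x, (D j x + (Φ j t x - ∫ s', Φ j s' x ∂P)) ^ 2 ∂ν)
        P := (integrable_finsetSum _ fun j _ => (hstep j).1).const_mul a
    -- With the earlier points fixed, some next point does no worse than the mean. Choosing points
    -- one by one in this way keeps all integrals over a single copy of `P`.
    obtain ⟨t, ht⟩ := exists_le_integral (hint1.add (hκ.const_mul b))
    rw [integral_add' hint1 (hκ.const_mul b), integral_const_mul, integral_const_mul,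
      integral_finsetSum _ fun j _ => (hstep j).1] at ht
    refine ⟨Fin.snoc s t, ?_⟩
    simp only [Fin.sum_univ_castSucc, Fin.snoc_castSucc, Fin.snoc_last]
    have hb := Finset.sum_le_sum fun j (_ : j ∈ Finset.univ) => (hstep j).2
    rw [Finset.sum_add_distrib] at hb
    have hb' := mul_le_mul_of_nonneg_left (hb.trans (add_le_add_right hVint _)) ha
    simp only [Pi.add_apply] at ht
    push_cast
    change a * ∑ j, ∫ x, (D j x + (Φ j t x - ∫ s', Φ j s' x ∂P)) ^ 2 ∂ν + _ ≤ _
    change a * ∑ j, ∫ x, D j x ^ 2 ∂ν + _ ≤ _ at hs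
    linarith

/-! ### Distributions with integrable Fourier transform -/

theorem IsGivenByFunction.congr_ae {d : ℕ} {T : 𝓢'(EuclideanSpace ℝ (Fin d), ℂ)}
    {g g' : EuclideanSpace ℝ (Fin d) → ℂ} (h : IsGivenByFunction T g) (hg : g =ᵐ[volume] g') :
    IsGivenByFunction T g' := by
  refine ⟨h.1.congr hg, fun φ => ?_⟩
  have e : (fun x => φ x * g x) =ᵐ[volume] fun x => φ x * g' x :=
    hg.mono fun x hx => by simp only [hx]
  exact ⟨(h.2 φ).1.congr e, (h.2 φ).2.trans (integral_congr_ae e)⟩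

theorem IsGivenByFunction.ae_eq {d : ℕ} {T : 𝓢'(EuclideanSpace ℝ (Fin d), ℂ)}
    {g g' : EuclideanSpace ℝ (Fin d) → ℂ} (h : IsGivenByFunction T g)
    (h' : IsGivenByFunction T g') : g =ᵐ[volume] g' := by
  refine ae_eq_of_integral_contDiff_smul_eq h.1 h'.1 fun φ hφ hc => ?_
  have hc' : HasCompactSupport (Complex.ofRealCLM ∘ φ) := hc.comp_left rfl
  let ψ := hc'.toSchwartzMap (Complex.ofRealCLM.contDiff.comp hφ)
  simpa [ψ] using (h.2 ψ).2.symm.trans (h'.2 ψ).2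

theorem IsGivenByFunction.weightedFourierNorm_eq {d : ℕ} {f : 𝓢'(EuclideanSpace ℝ (Fin d), ℂ)}
    {g : EuclideanSpace ℝ (Fin d) → ℂ} (h : IsGivenByFunction (𝓕 f) g)
    (w : EuclideanSpace ℝ (Fin d) → ℝ) :
    weightedFourierNorm w f = ∫⁻ ξ, ENNReal.ofReal (w ξ) * ‖g ξ‖ₑ := by
  refine le_antisymm (iInf₂_le g h) (le_iInf₂ fun g' h' => ?_)
  refine (lintegral_congr_ae ?_).le
  filter_upwards [h.ae_eq h'] with ξ hξ
  rw [hξ]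

theorem l1Norm_nonneg {d : ℕ} (ξ : EuclideanSpace ℝ (Fin d)) : 0 ≤ l1Norm ξ :=
  Finset.sum_nonneg fun _ _ => abs_nonneg _

theorem continuous_l1Norm {d : ℕ} : Continuous (l1Norm (d := d)) := by
  unfold l1Norm
  fun_prop

theorem one_le_logb_two_add_l1Norm {d : ℕ} (ξ : EuclideanSpace ℝ (Fin d)) :
    1 ≤ Real.logb 2 (2 + l1Norm ξ) := by
  have h := l1Norm_nonneg ξ
  rw [Real.le_logb_iff_rpow_le one_lt_two (by linarith)]
  simpa using h

theorem measurable_logb_two_add_l1Norm {d : ℕ} :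
    Measurable fun ξ : EuclideanSpace ℝ (Fin d) => Real.logb 2 (2 + l1Norm ξ) :=
  (Real.measurable_log.comp (measurable_const.add continuous_l1Norm.measurable)).div_const _

theorem integrable_weight_mul_norm {E : Type*} [MeasurableSpace E] {μ : Measure E} {w : E → ℝ}
    {g : E → ℂ} (hw : Measurable w) (hw0 : ∀ ξ, 0 ≤ w ξ) (hg : Measurable g)
    (hfin : ∫⁻ ξ, ENNReal.ofReal (w ξ) * ‖g ξ‖ₑ ∂μ < ⊤) :
    Integrable (fun ξ => w ξ * ‖g ξ‖) μ ∧
      (∫⁻ ξ, ENNReal.ofReal (w ξ) * ‖g ξ‖ₑ ∂μ).toReal = ∫ ξ, w ξ * ‖g ξ‖ ∂μ := by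
  have e : ∀ ξ, ENNReal.ofReal (w ξ) * ‖g ξ‖ₑ = ENNReal.ofReal (w ξ * ‖g ξ‖) := fun ξ => by
    rw [ENNReal.ofReal_mul (hw0 ξ), ofReal_norm]
  have hm : Measurable fun ξ => w ξ * ‖g ξ‖ := hw.mul hg.norm
  have h0 : ∀ ξ, 0 ≤ w ξ * ‖g ξ‖ := fun ξ => mul_nonneg (hw0 ξ) (norm_nonneg _)
  simp only [e] at hfin ⊢
  refine ⟨⟨hm.aestronglyMeasurable, ?_⟩, ?_⟩
  · rw [hasFiniteIntegral_iff_ofReal (Filter.Eventually.of_forall h0)]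
    exact hfin
  · rw [integral_eq_lintegral_of_nonneg_ae (Filter.Eventually.of_forall h0)
      hm.aestronglyMeasurable]

/-- A nonzero element of the log-Barron space has a measurable Fourier density, which computes both
norms. -/
theorem exists_fourier_density {d : ℕ} {f : 𝓢'(EuclideanSpace ℝ (Fin d), ℂ)}
    (hf : f ∈ logBarronSpace d 1) (hf0 : f ≠ 0) :
    ∃ g : EuclideanSpace ℝ (Fin d) → ℂ, Measurable g ∧ IsGivenByFunction (𝓕 f) g ∧
      Integrable (fun ξ => (1 + l1Norm ξ) * ‖g ξ‖) ∧
      Integrable (fun ξ => (1 + l1Norm ξ) * Real.logb 2 (2 + l1Norm ξ) * ‖g ξ‖) ∧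
      (barronNorm 1 f).toReal = ∫ ξ, (1 + l1Norm ξ) * ‖g ξ‖ ∧
      (logBarronNorm 1 f).toReal
        = ∫ ξ, (1 + l1Norm ξ) * Real.logb 2 (2 + l1Norm ξ) * ‖g ξ‖ ∧
      0 < ∫ ξ, (1 + l1Norm ξ) * ‖g ξ‖ := by
  have hf' : logBarronNorm 1 f < ⊤ := hf
  obtain ⟨g₀, hg₀, -⟩ : ∃ (g : EuclideanSpace ℝ (Fin d) → ℂ) (_ : IsGivenByFunction (𝓕 f) g),
      _ < ⊤ := by
    simpa only [logBarronNorm, weightedFourierNorm, iInf_lt_iff] using hf'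
  let g := hg₀.1.aestronglyMeasurable.mk g₀
  have hgm : Measurable g := hg₀.1.aestronglyMeasurable.stronglyMeasurable_mk.measurable
  have hg : IsGivenByFunction (𝓕 f) g := hg₀.congr_ae hg₀.1.aestronglyMeasurable.ae_eq_mk
  have hw1 : ∀ ξ : EuclideanSpace ℝ (Fin d), 0 ≤ 1 + l1Norm ξ := fun ξ => by
    linarith [l1Norm_nonneg ξ]
  have hlog : logBarronNorm 1 f = ∫⁻ ξ, ENNReal.ofReal ((1 + l1Norm ξ) *
      Real.logb 2 (2 + l1Norm ξ)) * ‖g ξ‖ₑ := by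
    rw [logBarronNorm, hg.weightedFourierNorm_eq]
    simp only [Real.rpow_one]
  have hbar : barronNorm 1 f = ∫⁻ ξ, ENNReal.ofReal (1 + l1Norm ξ) * ‖g ξ‖ₑ := by
    rw [barronNorm, hg.weightedFourierNorm_eq]
    simp only [Real.rpow_one]
  have hle : barronNorm 1 f ≤ logBarronNorm 1 f := by
    rw [hbar, hlog]
    refine lintegral_mono fun ξ => mul_le_mul_left (ENNReal.ofReal_le_ofReal ?_) _
    exact le_mul_of_one_le_right (hw1 ξ) (one_le_logb_two_add_l1Norm ξ)
  have hm1 : Measurable fun ξ : EuclideanSpace ℝ (Fin d) => 1 + l1Norm ξ :=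
    measurable_const.add continuous_l1Norm.measurable
  obtain ⟨hi1, he1⟩ := integrable_weight_mul_norm hm1 hw1 hgm
    (hbar ▸ hle.trans_lt hf')
  obtain ⟨hi2, he2⟩ := integrable_weight_mul_norm (hm1.mul measurable_logb_two_add_l1Norm)
    (fun ξ => mul_nonneg (hw1 ξ) (zero_le_one.trans (one_le_logb_two_add_l1Norm ξ))) hgm
    (hlog ▸ hf')
  refine ⟨g, hgm, hg, hi1, hi2, by rw [hbar, he1], by rw [hlog]; exact he2, ?_⟩
  rw [integral_pos_iff_support_of_nonneg (fun ξ => mul_nonneg (hw1 ξ) (norm_nonneg _)) hi1,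
    pos_iff_ne_zero]
  -- If the weighted integral vanished, `g` would be zero almost everywhere, and testing `𝓕 f` on
  -- `𝓕⁻ φ` would give `f = 0`.
  intro h0
  refine hf0 (ContinuousLinearMap.ext fun φ => ?_)
  have hg0 : g =ᵐ[volume] 0 := by
    rw [Filter.EventuallyEq, ae_iff]
    convert h0 using 2
    ext ξ
    have : 1 + l1Norm ξ ≠ 0 := by linarith [l1Norm_nonneg ξ]
    simp [this]
  have hφ : 𝓕 f (𝓕⁻ φ) = f φ := by
    rw [TemperedDistribution.fourier_apply, FourierTransform.fourier_fourierInv_eq]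
  refine hφ.symm.trans ((hg.2 _).2.trans (integral_eq_zero_of_ae ?_))
  filter_upwards [hg0] with ξ hξ
  simp [hξ]

/-- By Fubini the inverse transform moves from the test function to `g`, once `f φ` is written as `𝓕
f (𝓕⁻ φ)`. -/
theorem IsGivenByFunction.fourierInv {d : ℕ} {f : 𝓢'(EuclideanSpace ℝ (Fin d), ℂ)}
    {g : EuclideanSpace ℝ (Fin d) → ℂ} (h : IsGivenByFunction (𝓕 f) g) (hg : Integrable g) :
    IsGivenByFunction f (𝓕⁻ g) := by
  have hcont : Continuous (𝓕⁻ g) :=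
    VectorFourier.fourierIntegral_continuous Real.continuous_fourierChar
      (L := -innerₗ (EuclideanSpace ℝ (Fin d))) (by exact continuous_inner.neg) hg
  refine ⟨hcont.locallyIntegrable, fun φ => ⟨?_, ?_⟩⟩
  · refine φ.integrable.mul_bdd (c := ∫ ξ, ‖g ξ‖) hcont.aestronglyMeasurable
      (Filter.Eventually.of_forall fun x => ?_)
    exact VectorFourier.norm_fourierIntegral_le_integral_norm _ _ _ g x
  · have hφ : 𝓕 f (𝓕⁻ φ) = f φ := by
      rw [TemperedDistribution.fourier_apply, FourierTransform.fourier_fourierInv_eq]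
    have hflip : (-innerₗ (EuclideanSpace ℝ (Fin d))).flip = -innerₗ (EuclideanSpace ℝ (Fin d)) := by
      ext x y
      simp [real_inner_comm]
    have key := VectorFourier.integral_fourierIntegral_smul_eq_flip
      (μ := (volume : Measure (EuclideanSpace ℝ (Fin d))))
      (ν := (volume : Measure (EuclideanSpace ℝ (Fin d))))
      (L := -innerₗ (EuclideanSpace ℝ (Fin d))) Real.continuous_fourierChar
      (by exact continuous_inner.neg) φ.integrable hg
    rw [hflip] at key
    refine hφ.symm.trans ((h.2 _).2.trans ?_)
    rw [SchwartzMap.fourierInv_coe]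
    exact key

theorem IsGivenByFunction.of_isRealDistribution {d : ℕ} {f : 𝓢'(EuclideanSpace ℝ (Fin d), ℂ)}
    {g : EuclideanSpace ℝ (Fin d) → ℂ} (h : IsGivenByFunction f g) (hf : IsRealDistribution f) :
    IsGivenByFunction f fun x => ((g x).re : ℂ) := by
  have him : ∀ᵐ x, (g x).im = 0 := by
    refine ae_eq_zero_of_integral_contDiff_smul_eq_zero
      (fun x => ?_) fun φ hφ hc => ?_
    · obtain ⟨s, hs, hi⟩ := h.1 x
      exact ⟨s, hs, hi.im⟩
    · have hc' : HasCompactSupport (Complex.ofRealCLM ∘ φ) := hc.comp_left rfl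
      let ψ := hc'.toSchwartzMap (Complex.ofRealCLM.contDiff.comp hφ)
      have h1 := hf ψ fun x => by simp [ψ]
      rw [(h.2 ψ).2] at h1
      have h2 := integral_im (h.2 ψ).1
      simp only [RCLike.im_to_complex] at h2
      rw [h1] at h2
      simpa [ψ] using h2
  refine h.congr_ae ?_
  filter_upwards [him] with x hx
  exact Complex.ext (by simp) (by simp [hx])

/-- In polar form the argument of `g ξ` becomes a phase shift, measured in periods, of a real plane
wave. -/
theorem fourierInv_re_eq {d : ℕ} {g : EuclideanSpace ℝ (Fin d) → ℂ} (hg : Integrable g)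
    (x : EuclideanSpace ℝ (Fin d)) :
    (𝓕⁻ g x).re = ∫ ξ, ‖g ξ‖ * Real.cos (2 * Real.pi *
      (∑ j, ξ j * x j + (g ξ).arg / (2 * Real.pi))) := by
  have hint : Integrable fun ξ => Complex.exp (↑(2 * Real.pi * inner ℝ ξ x) * Complex.I) • g ξ := by
    refine hg.bdd_mul (c := 1) (by fun_prop) (Filter.Eventually.of_forall fun ξ => ?_)
    exact (Complex.norm_exp_ofReal_mul_I _).le
  rw [Real.fourierInv_eq']
  have h2 := integral_re hint
  simp only [RCLike.re_to_complex] at h2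
  rw [← h2]
  refine integral_congr_ae (Filter.Eventually.of_forall fun ξ => ?_)
  have e : Complex.exp (↑(2 * Real.pi * inner ℝ ξ x) * Complex.I) • g ξ
      = ‖g ξ‖ * Complex.exp (↑(2 * Real.pi * inner ℝ ξ x + (g ξ).arg) * Complex.I) := by
    conv_lhs => rw [← Complex.norm_mul_exp_arg_mul_I (g ξ)]
    rw [Complex.ofReal_add, add_mul, Complex.exp_add, smul_eq_mul]
    ring
  have hi : inner ℝ ξ x = ∑ j, ξ j * x j := by
    simp [PiLp.inner_apply, mul_comm]
  simp only [e]
  rw [Complex.re_ofReal_mul, Complex.exp_ofReal_mul_I_re, hi, mul_add,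
    mul_div_cancel₀ _ Real.two_pi_pos.ne']

/-! ### Random features -/

/-- The argument of a plane wave with frequency `ξ` and phase shift `θ ξ`. -/
noncomputable def wavePhase {d : ℕ} (θ : EuclideanSpace ℝ (Fin d) → ℝ)
    (ξ x : EuclideanSpace ℝ (Fin d)) : ℝ :=
  ∑ j, ξ j * x j + θ ξ

/-- The ramp feature of a frequency and a level (index `none`), with its partial derivatives
(index `some j`), scaled so that `M / (1 + |ξ|₁)` is its amplitude. -/
noncomputable def rampFeature {d : ℕ} (M : ℝ) (θ : EuclideanSpace ℝ (Fin d) → ℝ) :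
    Option (Fin d) → EuclideanSpace ℝ (Fin d) × unitInterval → EuclideanSpace ℝ (Fin d) → ℝ
  | none, s, x => M / (1 + l1Norm s.1) *
      (1 - Real.pi ^ 2 * Real.cos (Real.pi * s.2) * rampWave s.2 (wavePhase θ s.1 x))
  | some j, s, x => M / (1 + l1Norm s.1) *
      (-(Real.pi ^ 2 * Real.cos (Real.pi * s.2) * deriv (rampWave s.2) (wavePhase θ s.1 x))) * s.1 j

theorem one_add_l1Norm_pos {d : ℕ} (ξ : EuclideanSpace ℝ (Fin d)) : 0 < 1 + l1Norm ξ := by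
  linarith [l1Norm_nonneg ξ]

theorem measurable_wavePhase {d : ℕ} {θ : EuclideanSpace ℝ (Fin d) → ℝ} (hθ : Measurable θ) :
    Measurable (Function.uncurry (wavePhase θ)) := by
  have h : Continuous fun z : EuclideanSpace ℝ (Fin d) × EuclideanSpace ℝ (Fin d) =>
      ∑ j, z.1 j * z.2 j := by fun_prop
  exact h.measurable.add (hθ.comp measurable_fst)

theorem measurable_rampFeature {d : ℕ} (M : ℝ) {θ : EuclideanSpace ℝ (Fin d) → ℝ}
    (hθ : Measurable θ) (o : Option (Fin d)) :
    Measurable (Function.uncurry (rampFeature M θ o)) := by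
  have key : ∀ {Z : Type} [MeasurableSpace Z] {ξ x : Z → EuclideanSpace ℝ (Fin d)} {τ : Z → ℝ},
      Measurable ξ → Measurable x → Measurable τ →
      Measurable (fun z => M / (1 + l1Norm (ξ z)) *
        (1 - Real.pi ^ 2 * Real.cos (Real.pi * τ z) * rampWave (τ z) (wavePhase θ (ξ z) (x z)))) ∧
      Measurable (fun z => M / (1 + l1Norm (ξ z)) * (-(Real.pi ^ 2 * Real.cos (Real.pi * τ z) *
        deriv (rampWave (τ z)) (wavePhase θ (ξ z) (x z))))) := by
    intro Z _ ξ x τ hξ hx hτ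
    have h1 : Measurable fun z => M / (1 + l1Norm (ξ z)) :=
      ((continuous_l1Norm.measurable.comp hξ).const_add 1).const_div M
    have h2 : Measurable fun z => wavePhase θ (ξ z) (x z) :=
      (measurable_wavePhase hθ).comp (hξ.prodMk hx)
    have h3 : Measurable fun z => Real.pi ^ 2 * Real.cos (Real.pi * τ z) :=
      (Real.measurable_cos.comp (hτ.const_mul _)).const_mul _
    have h5 : Measurable fun z => rampWave (τ z) (wavePhase θ (ξ z) (x z)) := by
      have h := Measurable.comp (g := Function.uncurry rampWave)
        continuous_rampWave_uncurry.measurable (hτ.prodMk h2)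
      simpa only [Function.comp_def, Function.uncurry] using h
    have h6 : Measurable fun z => deriv (rampWave (τ z)) (wavePhase θ (ξ z) (x z)) := by
      have h := Measurable.comp (g := fun p : ℝ × ℝ => deriv (rampWave p.1) p.2)
        measurable_deriv_rampWave (hτ.prodMk h2)
      simpa only [Function.comp_def] using h
    exact ⟨h1.mul ((h3.mul h5).const_sub 1), h1.mul (h3.mul h6).neg⟩
  have hξ : Measurable fun z : (EuclideanSpace ℝ (Fin d) × unitInterval) ×
      EuclideanSpace ℝ (Fin d) => z.1.1 := measurable_fst.comp measurable_fst
  have hx : Measurable fun z : (EuclideanSpace ℝ (Fin d) × unitInterval) ×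
      EuclideanSpace ℝ (Fin d) => z.2 := measurable_snd
  have hτ : Measurable fun z : (EuclideanSpace ℝ (Fin d) × unitInterval) ×
      EuclideanSpace ℝ (Fin d) => (z.1.2 : ℝ) :=
    measurable_subtype_coe.comp (measurable_snd.comp measurable_fst)
  have hkey := key hξ hx hτ
  cases o with
  | none => exact hkey.1
  | some j =>
    have hj : Measurable fun ξ : EuclideanSpace ℝ (Fin d) => ξ j :=
      (by fun_prop : Continuous _).measurable
    exact hkey.2.mul (hj.comp hξ)

theorem sum_sq_le_l1Norm_sq {d : ℕ} (ξ : EuclideanSpace ℝ (Fin d)) :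
    ∑ j, ξ j ^ 2 ≤ l1Norm ξ ^ 2 := by
  rw [l1Norm, sq, Finset.sum_mul]
  refine Finset.sum_le_sum fun j _ => ?_
  rw [← sq_abs, sq]
  exact mul_le_mul_of_nonneg_left
    (Finset.single_le_sum (f := fun j => |ξ j|) (fun _ _ => abs_nonneg _) (Finset.mem_univ j))
    (abs_nonneg _)

/-- Up to the amplitude, the value is at most `1 + π² ≤ 2π²` and the gradient at most `2π² |ξ|₁`,
the wave having slope at most `2`. The claim follows from `1 + |ξ|₁² ≤ (1 + |ξ|₁)²`. -/
theorem sum_rampFeature_sq_le {d : ℕ} (M : ℝ) (θ : EuclideanSpace ℝ (Fin d) → ℝ)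
    (s : EuclideanSpace ℝ (Fin d) × unitInterval) (x : EuclideanSpace ℝ (Fin d)) :
    ∑ o, rampFeature M θ o s x ^ 2 ≤ 4 * Real.pi ^ 4 * M ^ 2 := by
  have hw := one_add_l1Norm_pos s.1
  have hpi := Real.pi_gt_three
  set c := Real.pi ^ 2 * Real.cos (Real.pi * s.2) with hc
  have hcb : |c| ≤ Real.pi ^ 2 := by
    rw [hc, abs_mul, abs_of_pos (by positivity : 0 < Real.pi ^ 2)]
    exact mul_le_of_le_one_right (by positivity) (Real.abs_cos_le_one _)
  have h0 : (1 - c * rampWave s.2 (wavePhase θ s.1 x)) ^ 2 ≤ (2 * Real.pi ^ 2) ^ 2 := by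
    refine sq_le_sq' ?_ ?_ <;>
    · have h1 : |c * rampWave s.2 (wavePhase θ s.1 x)| ≤ Real.pi ^ 2 * 1 := by
        rw [abs_mul, abs_of_nonneg (rampWave_nonneg _ _)]
        exact mul_le_mul hcb (rampWave_le_one s.2.2.1 _) (rampWave_nonneg _ _) (by positivity)
      rw [abs_le] at h1
      nlinarith [h1.1, h1.2]
  have h1 : (-(c * deriv (rampWave s.2) (wavePhase θ s.1 x))) ^ 2 ≤ (2 * Real.pi ^ 2) ^ 2 := by
    rw [neg_sq, ← sq_abs, abs_mul]
    refine pow_le_pow_left₀ (by positivity) ?_ 2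
    rw [mul_comm 2]
    exact mul_le_mul hcb (abs_deriv_rampWave_le _ _) (abs_nonneg _) (by positivity)
  rw [Fintype.sum_option]
  simp only [rampFeature, mul_pow]
  rw [← Finset.mul_sum]
  have h2 := sum_sq_le_l1Norm_sq s.1
  have hl := l1Norm_nonneg s.1
  calc (M / (1 + l1Norm s.1)) ^ 2 * (1 - c * rampWave s.2 (wavePhase θ s.1 x)) ^ 2
        + (M / (1 + l1Norm s.1)) ^ 2 *
          (-(c * deriv (rampWave s.2) (wavePhase θ s.1 x))) ^ 2 * ∑ j, s.1 j ^ 2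
      ≤ (M / (1 + l1Norm s.1)) ^ 2 * (2 * Real.pi ^ 2) ^ 2
        + (M / (1 + l1Norm s.1)) ^ 2 * (2 * Real.pi ^ 2) ^ 2 * l1Norm s.1 ^ 2 := by
        gcongr
    _ = 4 * Real.pi ^ 4 * M ^ 2 * ((1 + l1Norm s.1 ^ 2) / (1 + l1Norm s.1) ^ 2) := by
        field_simp
        ring
    _ ≤ 4 * Real.pi ^ 4 * M ^ 2 := by
        refine mul_le_of_le_one_right (by positivity) ((div_le_one (by positivity)).2 ?_)
        nlinarith

theorem abs_rampFeature_le {d : ℕ} (M : ℝ) (θ : EuclideanSpace ℝ (Fin d) → ℝ)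
    (o : Option (Fin d)) (s : EuclideanSpace ℝ (Fin d) × unitInterval)
    (x : EuclideanSpace ℝ (Fin d)) :
    |rampFeature M θ o s x| ≤ √(4 * Real.pi ^ 4 * M ^ 2) :=
  Real.abs_le_sqrt ((Finset.single_le_sum (f := fun o => rampFeature M θ o s x ^ 2)
    (fun _ _ => sq_nonneg _) (Finset.mem_univ o)).trans (sum_rampFeature_sq_le M θ s x))

theorem exists_lipschitzWith_rampFeature {d : ℕ} (M : ℝ) (θ : EuclideanSpace ℝ (Fin d) → ℝ)
    (s : EuclideanSpace ℝ (Fin d) × unitInterval) :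
    ∃ C, LipschitzWith C (rampFeature M θ none s) := by
  obtain ⟨C, hC⟩ := exists_lipschitzWith_sum_mul (fun j => s.1 j)
    (h := fun j (x : EuclideanSpace ℝ (Fin d)) => x j)
    (fun j => ⟨_, (EuclideanSpace.proj (𝕜 := ℝ) j).lipschitz⟩) (θ s.1)
  obtain ⟨C', hC'⟩ := exists_lipschitzWith_sum_mul (ι := Unit)
    (fun _ => -(M / (1 + l1Norm s.1) * (Real.pi ^ 2 * Real.cos (Real.pi * s.2))))
    (fun _ => ⟨_, (rampWave_lipschitz s.2).comp hC⟩) (M / (1 + l1Norm s.1))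
  refine ⟨C', ?_⟩
  have e : rampFeature M θ none s = fun x => ∑ _ : Unit,
      -(M / (1 + l1Norm s.1) * (Real.pi ^ 2 * Real.cos (Real.pi * s.2))) *
        (rampWave s.2 ∘ fun x => ∑ j, s.1 j * x j + θ s.1) x + M / (1 + l1Norm s.1) := by
    funext x
    simp only [rampFeature, wavePhase, Finset.univ_unique, Finset.sum_const, Finset.card_singleton,
      one_smul, Function.comp_apply]
    ring
  rw [e]
  exact hC'

theorem wavePhase_add_smul_single {d : ℕ} (θ : EuclideanSpace ℝ (Fin d) → ℝ)
    (ξ x : EuclideanSpace ℝ (Fin d)) (j : Fin d) (t : ℝ) :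
    wavePhase θ ξ (x + t • EuclideanSpace.single j 1) = wavePhase θ ξ x + t * ξ j := by
  have : ∀ i, ξ i * (x + t • EuclideanSpace.single j (1 : ℝ)) i
      = ξ i * x i + if i = j then ξ i * t else 0 := by
    intro i
    simp [mul_add, mul_comm]
  simp only [wavePhase, this, Finset.sum_add_distrib, Finset.sum_ite_eq', Finset.mem_univ, if_true]
  ring

/-- This is true even at kinks: the rules used for `deriv` under scaling and translation respect its
default value and need no differentiability. -/
theorem lineDeriv_rampFeature {d : ℕ} (M : ℝ) (θ : EuclideanSpace ℝ (Fin d) → ℝ)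
    (s : EuclideanSpace ℝ (Fin d) × unitInterval) (x : EuclideanSpace ℝ (Fin d)) (j : Fin d) :
    lineDeriv ℝ (rampFeature M θ none s) x (EuclideanSpace.single j 1)
      = rampFeature M θ (some j) s x := by
  have h : deriv (fun t => rampWave s.2 (wavePhase θ s.1 x + t * s.1 j)) 0
      = s.1 j * deriv (rampWave s.2) (wavePhase θ s.1 x) := by
    have h1 := deriv_comp_mul_left (s.1 j) (fun t => rampWave s.2 (wavePhase θ s.1 x + t)) 0
    rw [mul_zero, deriv_comp_const_add, add_zero, smul_eq_mul] at h1
    simpa only [mul_comm] using h1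
  simp only [lineDeriv, rampFeature, wavePhase_add_smul_single]
  rw [deriv_const_mul_field, deriv_const_sub, deriv_const_mul_field, h]
  ring

/-! ### The sampling measure -/

/-- The distribution of the frequencies, with density proportional to `(1 + |ξ|₁) r ξ`. -/
noncomputable def frequencyMeasure {d : ℕ} (r : EuclideanSpace ℝ (Fin d) → ℝ) (M : ℝ) :
    Measure (EuclideanSpace ℝ (Fin d)) :=
  volume.withDensity fun ξ => ENNReal.ofReal ((1 + l1Norm ξ) * r ξ / M)

theorem measurable_frequency_density {d : ℕ} {r : EuclideanSpace ℝ (Fin d) → ℝ}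
    (hr : Measurable r) (M : ℝ) : Measurable fun ξ => (1 + l1Norm ξ) * r ξ / M :=
  ((measurable_const.add continuous_l1Norm.measurable).mul hr).div_const M

theorem isProbabilityMeasure_frequencyMeasure {d : ℕ} {r : EuclideanSpace ℝ (Fin d) → ℝ}
    (hr0 : ∀ ξ, 0 ≤ r ξ) (hi : Integrable fun ξ => (1 + l1Norm ξ) * r ξ)
    (hM : 0 < ∫ ξ, (1 + l1Norm ξ) * r ξ) :
    IsProbabilityMeasure (frequencyMeasure r (∫ ξ, (1 + l1Norm ξ) * r ξ)) := by
  refine ⟨?_⟩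
  rw [frequencyMeasure, withDensity_apply _ MeasurableSet.univ, Measure.restrict_univ,
    ← ofReal_integral_eq_lintegral_ofReal (hi.div_const _) (Filter.Eventually.of_forall fun ξ =>
      div_nonneg (mul_nonneg (one_add_l1Norm_pos ξ).le (hr0 ξ)) hM.le),
    integral_div, div_self hM.ne', ENNReal.ofReal_one]

theorem integral_frequencyMeasure {d : ℕ} {r : EuclideanSpace ℝ (Fin d) → ℝ} (hr : Measurable r)
    (hr0 : ∀ ξ, 0 ≤ r ξ) {M : ℝ} (hM : 0 < M) (h : EuclideanSpace ℝ (Fin d) → ℝ) :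
    ∫ ξ, h ξ ∂(frequencyMeasure r M) = ∫ ξ, (1 + l1Norm ξ) * r ξ / M * h ξ := by
  rw [frequencyMeasure, integral_withDensity_eq_integral_toReal_smul
    (measurable_frequency_density hr M).ennreal_ofReal
    (Filter.Eventually.of_forall fun _ => ENNReal.ofReal_lt_top)]
  refine integral_congr_ae (Filter.Eventually.of_forall fun ξ => ?_)
  simp only [smul_eq_mul]
  rw [ENNReal.toReal_ofReal (div_nonneg (mul_nonneg (one_add_l1Norm_pos ξ).le (hr0 ξ)) hM.le)]

theorem integrable_frequencyMeasure_iff {d : ℕ} {r : EuclideanSpace ℝ (Fin d) → ℝ}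
    (hr : Measurable r) (hr0 : ∀ ξ, 0 ≤ r ξ) {M : ℝ} (hM : 0 < M)
    (h : EuclideanSpace ℝ (Fin d) → ℝ) :
    Integrable h (frequencyMeasure r M) ↔ Integrable fun ξ => (1 + l1Norm ξ) * r ξ / M * h ξ := by
  rw [frequencyMeasure, integrable_withDensity_iff_integrable_smul'
    (measurable_frequency_density hr M).ennreal_ofReal
    (Filter.Eventually.of_forall fun _ => ENNReal.ofReal_lt_top)]
  refine integrable_congr (Filter.Eventually.of_forall fun ξ => ?_)
  simp only [smul_eq_mul]
  rw [ENNReal.toReal_ofReal (div_nonneg (mul_nonneg (one_add_l1Norm_pos ξ).le (hr0 ξ)) hM.le)]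

theorem integral_unitInterval (h : ℝ → ℝ) : ∫ τ : unitInterval, h τ = ∫ τ in (0 : ℝ)..1, h τ := by
  rw [intervalIntegral.integral_of_le zero_le_one, ← integral_Icc_eq_integral_Ioc]
  exact integral_subtype measurableSet_Icc h

/-- The weight `(1 + |ξ|₁) / M` of the frequency density cancels the amplitude, leaving `r`. The
integral over the level then turns ramps into the cosine and its derivative. -/
theorem integral_rampFeature {d : ℕ} {r θ : EuclideanSpace ℝ (Fin d) → ℝ} (hr : Measurable r)
    (hr0 : ∀ ξ, 0 ≤ r ξ) (hθ : Measurable θ) {M : ℝ} (hM : 0 < M)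
    [IsProbabilityMeasure (frequencyMeasure r M)] (x : EuclideanSpace ℝ (Fin d)) :
    (∫ s, rampFeature M θ none s x ∂((frequencyMeasure r M).prod volume)
      = ∫ ξ, r ξ * Real.cos (2 * Real.pi * wavePhase θ ξ x)) ∧
    ∀ j, ∫ s, rampFeature M θ (some j) s x ∂((frequencyMeasure r M).prod volume)
      = ∫ ξ, r ξ * (-(2 * Real.pi * Real.sin (2 * Real.pi * wavePhase θ ξ x)) * ξ j) := by
  have hint : ∀ o, Integrable (fun s => rampFeature M θ o s x)
      ((frequencyMeasure r M).prod volume) := fun o =>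
    Integrable.of_bound ((measurable_rampFeature M hθ o).comp
      measurable_prodMk_right).aestronglyMeasurable _
      (Filter.Eventually.of_forall fun s => abs_rampFeature_le M θ o s x)
  constructor
  · rw [integral_prod _ (hint none), integral_frequencyMeasure hr hr0 hM]
    refine integral_congr_ae (Filter.Eventually.of_forall fun ξ => ?_)
    have hw := one_add_l1Norm_pos ξ
    simp only [rampFeature]
    rw [integral_const_mul, integral_unitInterval
      (fun τ => 1 - Real.pi ^ 2 * Real.cos (Real.pi * τ) * rampWave τ (wavePhase θ ξ x)),
      integral_cos_mul_rampWave]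
    field_simp
  · intro j
    rw [integral_prod _ (hint (some j)), integral_frequencyMeasure hr hr0 hM]
    refine integral_congr_ae (Filter.Eventually.of_forall fun ξ => ?_)
    have hw := one_add_l1Norm_pos ξ
    simp only [rampFeature]
    rw [integral_mul_const, integral_const_mul, integral_unitInterval
      (fun τ => -(Real.pi ^ 2 * Real.cos (Real.pi * τ) * deriv (rampWave τ) (wavePhase θ ξ x))),
      integral_cos_mul_deriv_rampWave]
    field_simp

/-! ### Superpositions of plane waves -/

/-- The superposition of plane waves with amplitudes `r` and phase shifts `θ`. -/
noncomputable def waveSum {d : ℕ} (r θ : EuclideanSpace ℝ (Fin d) → ℝ)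
    (x : EuclideanSpace ℝ (Fin d)) : ℝ :=
  ∫ ξ, r ξ * Real.cos (2 * Real.pi * wavePhase θ ξ x)

theorem measurable_wavePhase_left {d : ℕ} {θ : EuclideanSpace ℝ (Fin d) → ℝ} (hθ : Measurable θ)
    (x : EuclideanSpace ℝ (Fin d)) : Measurable fun ξ => wavePhase θ ξ x :=
  (measurable_wavePhase hθ).comp measurable_prodMk_right

theorem integrable_of_weighted {d : ℕ} {r h : EuclideanSpace ℝ (Fin d) → ℝ} (hr : Measurable r)
    (hr0 : ∀ ξ, 0 ≤ r ξ) (hi : Integrable fun ξ => (1 + l1Norm ξ) * r ξ) (hh : Measurable h)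
    {C : ℝ} (hC : ∀ ξ, |h ξ| ≤ C * (1 + l1Norm ξ)) : Integrable fun ξ => r ξ * h ξ := by
  refine (hi.const_mul C).mono' (hr.mul hh).aestronglyMeasurable
    (Filter.Eventually.of_forall fun ξ => ?_)
  rw [Real.norm_eq_abs, abs_mul, abs_of_nonneg (hr0 ξ)]
  nlinarith [hC ξ, hr0 ξ]

theorem integrable_wave {d : ℕ} {r θ : EuclideanSpace ℝ (Fin d) → ℝ} (hr : Measurable r)
    (hr0 : ∀ ξ, 0 ≤ r ξ) (hi : Integrable fun ξ => (1 + l1Norm ξ) * r ξ) (hθ : Measurable θ)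
    (x : EuclideanSpace ℝ (Fin d)) :
    Integrable fun ξ => r ξ * Real.cos (2 * Real.pi * wavePhase θ ξ x) := by
  refine integrable_of_weighted hr hr0 hi (C := 1)
    (Real.measurable_cos.comp ((measurable_wavePhase_left hθ x).const_mul _)) fun ξ => ?_
  have := Real.abs_cos_le_one (2 * Real.pi * wavePhase θ ξ x)
  linarith [l1Norm_nonneg ξ]

theorem abs_coord_le_l1Norm {d : ℕ} (ξ : EuclideanSpace ℝ (Fin d)) (j : Fin d) :
    |ξ j| ≤ l1Norm ξ :=
  Finset.single_le_sum (f := fun j => |ξ j|) (fun _ _ => abs_nonneg _) (Finset.mem_univ j)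

theorem abs_cos_sub_cos_le (a b : ℝ) : |Real.cos a - Real.cos b| ≤ |a - b| := by
  have h : LipschitzWith 1 Real.cos :=
    lipschitzWith_of_nnnorm_deriv_le Real.differentiable_cos fun x => by
      rw [Real.deriv_cos', nnnorm_neg, ← NNReal.coe_le_coe]
      exact Real.abs_sin_le_one x
  simpa [Real.dist_eq] using h.dist_le_mul a b

theorem exists_lipschitzWith_waveSum {d : ℕ} {r θ : EuclideanSpace ℝ (Fin d) → ℝ}
    (hr : Measurable r) (hr0 : ∀ ξ, 0 ≤ r ξ) (hi : Integrable fun ξ => (1 + l1Norm ξ) * r ξ)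
    (hθ : Measurable θ) : ∃ C, LipschitzWith C (waveSum r θ) := by
  refine ⟨_, LipschitzWith.of_dist_le_mul (K := Real.toNNReal (2 * Real.pi *
    ∫ ξ, (1 + l1Norm ξ) * r ξ)) fun x y => ?_⟩
  rw [Real.coe_toNNReal _ (mul_nonneg Real.two_pi_pos.le
    (integral_nonneg fun ξ => mul_nonneg (one_add_l1Norm_pos ξ).le (hr0 ξ))), Real.dist_eq,
    waveSum, waveSum, ← integral_sub (integrable_wave hr hr0 hi hθ x)
      (integrable_wave hr hr0 hi hθ y), mul_comm (2 * Real.pi), mul_assoc, ← integral_mul_const]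
  rw [← Real.norm_eq_abs]
  refine norm_integral_le_of_norm_le (hi.mul_const _) (Filter.Eventually.of_forall fun ξ => ?_)
  rw [← mul_sub, Real.norm_eq_abs, abs_mul, abs_of_nonneg (hr0 ξ)]
  have h1 : |wavePhase θ ξ x - wavePhase θ ξ y| ≤ l1Norm ξ * dist x y := by
    rw [wavePhase, wavePhase, add_sub_add_right_eq_sub, ← Finset.sum_sub_distrib, l1Norm,
      Finset.sum_mul]
    refine (Finset.abs_sum_le_sum_abs _ _).trans (Finset.sum_le_sum fun j _ => ?_)
    rw [← mul_sub, abs_mul, dist_eq_norm]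
    exact mul_le_mul_of_nonneg_left (PiLp.norm_apply_le (x - y) j) (abs_nonneg _)
  have h2 := abs_cos_sub_cos_le (2 * Real.pi * wavePhase θ ξ x) (2 * Real.pi * wavePhase θ ξ y)
  rw [← mul_sub, abs_mul, abs_of_pos Real.two_pi_pos] at h2
  calc r ξ * |_| ≤ r ξ * (2 * Real.pi * ((1 + l1Norm ξ) * dist x y)) := by
        refine mul_le_mul_of_nonneg_left (h2.trans (mul_le_mul_of_nonneg_left (h1.trans ?_)
          Real.two_pi_pos.le)) (hr0 ξ)
        exact mul_le_mul_of_nonneg_right (by linarith) dist_nonneg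
    _ = (1 + l1Norm ξ) * r ξ * (2 * Real.pi * dist x y) := by ring

/-- Differentiation under the integral, dominated by the integrable function `2π (1 + |ξ|₁) r ξ`. -/
theorem hasLineDerivAt_waveSum {d : ℕ} {r θ : EuclideanSpace ℝ (Fin d) → ℝ}
    (hr : Measurable r) (hr0 : ∀ ξ, 0 ≤ r ξ) (hi : Integrable fun ξ => (1 + l1Norm ξ) * r ξ)
    (hθ : Measurable θ) (x : EuclideanSpace ℝ (Fin d)) (j : Fin d) :
    HasLineDerivAt ℝ (waveSum r θ)
      (∫ ξ, r ξ * (-(2 * Real.pi * Real.sin (2 * Real.pi * wavePhase θ ξ x)) * ξ j)) x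
      (EuclideanSpace.single j 1) := by
  have hcoord : Measurable fun ξ : EuclideanSpace ℝ (Fin d) => ξ j :=
    (by fun_prop : Continuous _).measurable
  have key := (hasDerivAt_integral_of_dominated_loc_of_deriv_le (𝕜 := ℝ) (μ := volume) (x₀ := 0)
    (F := fun (t : ℝ) ξ => r ξ * Real.cos (2 * Real.pi * (wavePhase θ ξ x + t * ξ j)))
    (F' := fun (t : ℝ) ξ =>
      r ξ * (-(2 * Real.pi * Real.sin (2 * Real.pi * (wavePhase θ ξ x + t * ξ j))) * ξ j))
    (bound := fun ξ => 2 * Real.pi * ((1 + l1Norm ξ) * r ξ)) Filter.univ_mem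
    (Filter.Eventually.of_forall fun t => (hr.mul (Real.measurable_cos.comp
      (((measurable_wavePhase_left hθ x).add (hcoord.const_mul t)).const_mul _))).aestronglyMeasurable)
    (by simpa using integrable_wave hr hr0 hi hθ x)
    (hr.mul ((((Real.measurable_sin.comp
      (((measurable_wavePhase_left hθ x).add (hcoord.const_mul 0)).const_mul _)).const_mul
        _).neg).mul hcoord)).aestronglyMeasurable
    (Filter.Eventually.of_forall fun ξ t _ => ?_) (hi.const_mul _)
    (Filter.Eventually.of_forall fun ξ t _ => ?_)).2
  · rw [HasLineDerivAt]
    simpa only [waveSum, wavePhase_add_smul_single, zero_mul, add_zero] using key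
  · have h1 := Real.abs_sin_le_one (2 * Real.pi * (wavePhase θ ξ x + t * ξ j))
    have h2 := abs_coord_le_l1Norm ξ j
    rw [Real.norm_eq_abs, abs_mul, abs_mul, abs_neg, abs_mul, abs_of_nonneg (hr0 ξ),
      abs_of_pos Real.two_pi_pos]
    calc r ξ * (2 * Real.pi * |_| * |ξ j|) ≤ r ξ * (2 * Real.pi * 1 * (1 + l1Norm ξ)) := by
          gcongr
          · exact hr0 ξ
          · linarith
      _ = 2 * Real.pi * ((1 + l1Norm ξ) * r ξ) := by ring
  · have h1 : HasDerivAt (fun t => 2 * Real.pi * (wavePhase θ ξ x + t * ξ j))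
        (2 * Real.pi * (1 * ξ j)) t :=
      (((hasDerivAt_id t).mul_const (ξ j)).const_add _).const_mul _
    exact (h1.cos.const_mul (r ξ)).congr_deriv (by ring)

/-! ### The Sobolev norm of a Lipschitz function -/

theorem LipschitzWith.isWeakPartialDeriv {d : ℕ} {u : EuclideanSpace ℝ (Fin d) → ℝ} {C : NNReal}
    (hu : LipschitzWith C u) (j : Fin d) :
    IsWeakPartialDeriv j u fun x => lineDeriv ℝ u x (EuclideanSpace.single j 1) := by
  refine ⟨hu.continuous.locallyIntegrable, hu.locallyIntegrable_lineDeriv _, fun φ hφ hc => ?_⟩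
  obtain ⟨D, hD⟩ := ContDiff.lipschitzWith_of_hasCompactSupport hc hφ (by simp)
  rw [hu.integral_lineDeriv_mul_eq hD hc, ← integral_neg]
  refine integral_congr_ae (Filter.Eventually.of_forall fun x => ?_)
  have h : DifferentiableAt ℝ φ x := hφ.differentiable (by simp) x
  simp only [h.lineDeriv_eq_fderiv, map_neg]
  ring

theorem eLpNorm_two_sq_eq_ofReal {X : Type*} [MeasurableSpace X] {μ : Measure X} {h : X → ℝ}
    (hi : Integrable (fun x => h x ^ 2) μ) :
    eLpNorm h 2 μ ^ 2 = ENNReal.ofReal (∫ x, h x ^ 2 ∂μ) := by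
  have h2 := eLpNorm_nnreal_pow_eq_lintegral (f := h) (μ := μ) (p := 2) two_ne_zero
  rw [ofReal_integral_eq_lintegral_ofReal hi (Filter.Eventually.of_forall fun x => sq_nonneg _)]
  have e : ∀ x, ‖h x‖ₑ ^ ((2 : NNReal) : ℝ) = ENNReal.ofReal (h x ^ 2) := fun x => by
    rw [← sq_abs, ENNReal.ofReal_pow (abs_nonneg _), ← Real.norm_eq_abs, ofReal_norm,
      NNReal.coe_ofNat, ENNReal.rpow_ofNat]
  simp only [e] at h2
  rw [← h2, NNReal.coe_ofNat, ENNReal.rpow_ofNat, ENNReal.coe_ofNat]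

theorem h1Norm_le_of_lipschitzWith {d : ℕ} {Ω : Set (EuclideanSpace ℝ (Fin d))}
    {u : EuclideanSpace ℝ (Fin d) → ℝ} {C : NNReal} (hu : LipschitzWith C u)
    {e : Option (Fin d) → EuclideanSpace ℝ (Fin d) → ℝ}
    (he : ∀ o, Integrable (fun x => e o x ^ 2) (volume.restrict Ω))
    (h0 : ∀ᵐ x ∂volume.restrict Ω, u x = e none x)
    (h1 : ∀ j, ∀ᵐ x ∂volume.restrict Ω,
      lineDeriv ℝ u x (EuclideanSpace.single j 1) = e (some j) x)
    {B : ℝ} (hB : 0 ≤ B) (hle : ∑ o, ∫ x in Ω, e o x ^ 2 ≤ B ^ 2) :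
    h1Norm Ω u ≤ ENNReal.ofReal B := by
  refine (iInf₂_le _ fun j => hu.isWeakPartialDeriv j).trans ?_
  have hsum : eLpNorm u 2 (volume.restrict Ω) ^ 2 + ∑ j, eLpNorm
      (fun x => lineDeriv ℝ u x (EuclideanSpace.single j 1)) 2 (volume.restrict Ω) ^ 2
      = ENNReal.ofReal (∑ o, ∫ x in Ω, e o x ^ 2) := by
    rw [ENNReal.ofReal_sum_of_nonneg fun o _ => integral_nonneg fun x => sq_nonneg _,
      Fintype.sum_option, eLpNorm_congr_ae h0, eLpNorm_two_sq_eq_ofReal (he none)]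
    congr 1
    refine Finset.sum_congr rfl fun j _ => ?_
    rw [eLpNorm_congr_ae (h1 j), eLpNorm_two_sq_eq_ofReal (he (some j))]
  rw [hsum]
  calc ENNReal.ofReal (∑ o, ∫ x in Ω, e o x ^ 2) ^ (1 / 2 : ℝ)
      ≤ ENNReal.ofReal (B ^ 2) ^ (1 / 2 : ℝ) :=
        ENNReal.rpow_le_rpow (ENNReal.ofReal_le_ofReal hle) (by norm_num)
    _ = ENNReal.ofReal B := by
        rw [ENNReal.ofReal_rpow_of_nonneg (sq_nonneg B) (by norm_num), ← Real.sqrt_eq_rpow,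
          Real.sqrt_sq hB]

/-- The network is known only on the cube, so its derivatives are known only in the interior. The
boundary of a convex set is null. -/
theorem ae_mem_interior_cube {d : ℕ} {Ω : Set (EuclideanSpace ℝ (Fin d))} (hΩ : MeasurableSet Ω)
    (hΩ_cube : Ω ⊆ {x | ∀ i, x i ∈ Set.Icc (0 : ℝ) 1}) :
    ∀ᵐ x ∂volume.restrict Ω,
      x ∈ interior {x : EuclideanSpace ℝ (Fin d) | ∀ i, x i ∈ Set.Icc (0 : ℝ) 1} := by
  have hconv : Convex ℝ {x : EuclideanSpace ℝ (Fin d) | ∀ i, x i ∈ Set.Icc (0 : ℝ) 1} := by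
    intro x hx y hy a b ha hb hab i
    exact convex_Icc (0 : ℝ) 1 (hx i) (hy i) ha hb hab
  have hae : ∀ᵐ x, x ∉ frontier {x : EuclideanSpace ℝ (Fin d) | ∀ i, x i ∈ Set.Icc (0 : ℝ) 1} :=
    measure_eq_zero_iff_ae_notMem.1 (hconv.addHaar_frontier volume)
  filter_upwards [ae_restrict_mem hΩ, ae_restrict_of_ae hae] with x hx hxf
  by_contra hxi
  exact hxf ⟨subset_closure (hΩ_cube hx), hxi⟩

/-! ### Sampled networks -/

/-- Each quantity is weighted by the mean bound of the other, so both contribute equally to the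
bound for the weighted sum. Dropping either nonnegative term leaves the other at most twice its mean
bound. -/
theorem exists_sample_sq_error_le_and_cost_le {S X ι : Type*} [MeasurableSpace S]
    [MeasurableSpace X] [Fintype ι] {P : Measure S} [IsProbabilityMeasure P] {ν : Measure X}
    [IsFiniteMeasure ν] {Φ : ι → S → X → ℝ} (hΦ : ∀ j, Measurable (Function.uncurry (Φ j)))
    {V : ℝ} (hV0 : 0 < V) (hV : ∀ s x, ∑ j, Φ j s x ^ 2 ≤ V) {κ : S → ℝ} (hκ0 : ∀ s, 0 ≤ κ s)
    (hκ : Integrable κ P) (hκpos : 0 < ∫ s, κ s ∂P) (n : ℕ) :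
    ∃ s : Fin n → S,
      ∑ j, ∫ x, (∑ i, (Φ j (s i) x - ∫ s', Φ j s' x ∂P)) ^ 2 ∂ν ≤ 2 * n * (V * ν.real Set.univ) ∧
      ∑ i, κ (s i) ≤ 2 * n * ∫ s, κ s ∂P := by
  -- For `ν = 0` the weight of the cost would vanish; the error is then zero and only the cost is
  -- averaged.
  rcases eq_or_ne ν 0 with rfl | hν
  · obtain ⟨s, hs⟩ := exists_sample_sq_error_add_cost_le (ν := (0 : Measure X)) hΦ hV hκ
      (a := 0) (b := 1) le_rfl n
    refine ⟨s, by simp, ?_⟩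
    simp only [zero_mul, zero_add, one_mul] at hs
    have : 0 ≤ n * ∫ s, κ s ∂P := by positivity
    linarith
  · have hT : 0 < V * ν.real Set.univ := by
      refine mul_pos hV0 (ENNReal.toReal_pos ?_ (measure_ne_top _ _))
      rwa [Ne, Measure.measure_univ_eq_zero]
    obtain ⟨s, hs⟩ := exists_sample_sq_error_add_cost_le (ν := ν) hΦ hV hκ
      (a := ∫ s, κ s ∂P) (b := V * ν.real Set.univ) hκpos.le n
    have he : 0 ≤ ∑ j, ∫ x, (∑ i, (Φ j (s i) x - ∫ s', Φ j s' x ∂P)) ^ 2 ∂ν :=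
      Finset.sum_nonneg fun j _ => integral_nonneg fun x => sq_nonneg _
    have hc : 0 ≤ ∑ i, κ (s i) := Finset.sum_nonneg fun i _ => hκ0 _
    refine ⟨s, le_of_mul_le_mul_left ?_ hκpos, le_of_mul_le_mul_left ?_ hT⟩
    · have := mul_nonneg hT.le hc
      linarith
    · have := mul_nonneg hκpos.le he
      linarith

/-- The number of doublings that resolve a given frequency. -/
noncomputable def doublings {d : ℕ} (ξ : EuclideanSpace ℝ (Fin d)) : ℕ :=
  ⌈Real.logb 2 (1 + l1Norm ξ)⌉₊

theorem one_add_l1Norm_le_two_pow_doublings {d : ℕ} (ξ : EuclideanSpace ℝ (Fin d)) :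
    1 + l1Norm ξ ≤ 2 ^ doublings ξ := by
  rw [← Real.rpow_natCast, ← Real.logb_le_iff_le_rpow one_lt_two (one_add_l1Norm_pos ξ)]
  exact Nat.le_ceil _

/-- With `t = |ξ|₁`, the left side is at most `log₂ (8 (1 + t))`, and `8 (1 + t) ≤ (2 + t)³`. -/
theorem doublings_add_two_le {d : ℕ} (ξ : EuclideanSpace ℝ (Fin d)) :
    (doublings ξ : ℝ) + 2 ≤ 3 * Real.logb 2 (2 + l1Norm ξ) := by
  have hl := l1Norm_nonneg ξ
  have h1 : (doublings ξ : ℝ) < Real.logb 2 (1 + l1Norm ξ) + 1 :=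
    Nat.ceil_lt_add_one (Real.logb_nonneg one_lt_two (by linarith))
  have h2 : Real.logb 2 (8 * (1 + l1Norm ξ)) ≤ Real.logb 2 ((2 + l1Norm ξ) ^ 3) :=
    Real.logb_le_logb_of_le one_lt_two (by positivity)
      (by nlinarith [pow_nonneg hl 3, sq_nonneg (l1Norm ξ)])
  have h8 : Real.logb 2 8 = 3 := by
    rw [show (8 : ℝ) = 2 ^ (3 : ℕ) by norm_num, Real.logb_pow, Real.logb_self_eq_one one_lt_two]
    norm_num
  rw [Real.logb_mul (by norm_num) (one_add_l1Norm_pos ξ).ne', h8, Real.logb_pow] at h2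
  push_cast at h2
  linarith

/-- The average of sampled ramp features is a network on the unit cube. -/
theorem exists_network_average_rampFeature {d : ℕ} (M : ℝ) (θ : EuclideanSpace ℝ (Fin d) → ℝ)
    {m : ℕ} (hm : 1 ≤ m) (s : Fin m → EuclideanSpace ℝ (Fin d) × unitInterval) :
    ∃ F, IsReLUNetwork (∑ i, (doublings (s i).1 + 2)) (d + 4) F ∧
      ∀ x ∈ {x : EuclideanSpace ℝ (Fin d) | ∀ i, x i ∈ Set.Icc (0 : ℝ) 1},
        F x = (m : ℝ)⁻¹ * ∑ i, rampFeature M θ none (s i) x := by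
  obtain ⟨n, rfl⟩ : ∃ n, m = n + 1 := ⟨m - 1, by omega⟩
  obtain ⟨F, hF, hFQ⟩ := exists_network_sum_rampWave (fun x hx => hx) n (fun i => (s i).1)
    (fun i => θ (s i).1) (fun i => (s i).2)
    (fun i => -(((n + 1 : ℕ) : ℝ)⁻¹ * (M / (1 + l1Norm (s i).1) *
      (Real.pi ^ 2 * Real.cos (Real.pi * (s i).2)))))
    (fun i => (s i).2.2.1) (fun i => doublings (s i).1)
    (fun i => one_add_l1Norm_le_two_pow_doublings _)
    (∑ i, ((n + 1 : ℕ) : ℝ)⁻¹ * (M / (1 + l1Norm (s i).1)))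
  refine ⟨F, hF, fun x hx => ?_⟩
  rw [hFQ x hx, ← Finset.sum_add_distrib, Finset.mul_sum]
  refine Finset.sum_congr rfl fun i _ => ?_
  simp only [rampFeature, wavePhase]
  ring

/-- The sampled features are Lipschitz, hence differentiable along the coordinate direction almost
everywhere, and near an interior point of `Q` the network coincides with their average. -/
theorem ae_lineDeriv_waveSum_sub_network {d : ℕ} {r θ : EuclideanSpace ℝ (Fin d) → ℝ}
    (hr : Measurable r) (hr0 : ∀ ξ, 0 ≤ r ξ) (hi : Integrable fun ξ => (1 + l1Norm ξ) * r ξ)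
    (hθ : Measurable θ) {M : ℝ} {m : ℕ} {s : Fin m → EuclideanSpace ℝ (Fin d) × unitInterval}
    {F : EuclideanSpace ℝ (Fin d) → ℝ} {Q : Set (EuclideanSpace ℝ (Fin d))}
    (hF : ∀ x ∈ Q, F x = (m : ℝ)⁻¹ * ∑ i, rampFeature M θ none (s i) x) (j : Fin d) :
    ∀ᵐ x, x ∈ interior Q →
      lineDeriv ℝ (fun x => waveSum r θ x - F x) x (EuclideanSpace.single j 1)
        = (∫ ξ, r ξ * (-(2 * Real.pi * Real.sin (2 * Real.pi * wavePhase θ ξ x)) * ξ j))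
          - (m : ℝ)⁻¹ * ∑ i, rampFeature M θ (some j) (s i) x := by
  have hdiff : ∀ᵐ x, ∀ i, LineDifferentiableAt ℝ (rampFeature M θ none (s i)) x
      (EuclideanSpace.single j 1) := by
    rw [ae_all_iff]
    intro i
    obtain ⟨C, hC⟩ := exists_lipschitzWith_rampFeature M θ (s i)
    exact hC.ae_lineDifferentiableAt _
  filter_upwards [hdiff] with x hx hxQ
  have hev : (fun x => waveSum r θ x - F x) =ᶠ[nhds x]
      fun x => waveSum r θ x - (m : ℝ)⁻¹ * ∑ i, rampFeature M θ none (s i) x := by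
    filter_upwards [mem_interior_iff_mem_nhds.1 hxQ] with y hy
    rw [hF y hy]
  rw [hev.lineDeriv_eq]
  refine HasLineDerivAt.lineDeriv ?_
  have h1 : ∀ i, HasLineDerivAt ℝ (rampFeature M θ none (s i)) (rampFeature M θ (some j) (s i) x) x
      (EuclideanSpace.single j 1) := fun i => by
    rw [← lineDeriv_rampFeature]
    exact (hx i).hasLineDerivAt
  exact HasDerivAt.sub (hasLineDerivAt_waveSum hr hr0 hi hθ x j)
    ((HasDerivAt.fun_sum fun i _ => h1 i).const_mul _)

/-- Superpositions of plane waves are approximated by deep networks of width `d + 4`. -/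
theorem exists_network_h1Norm_waveSum_sub_le {d : ℕ} {r θ : EuclideanSpace ℝ (Fin d) → ℝ}
    (hr : Measurable r) (hr0 : ∀ ξ, 0 ≤ r ξ) (hi : Integrable fun ξ => (1 + l1Norm ξ) * r ξ)
    (hlog : Integrable fun ξ => (1 + l1Norm ξ) * Real.logb 2 (2 + l1Norm ξ) * r ξ)
    (hM : 0 < ∫ ξ, (1 + l1Norm ξ) * r ξ) (hθ : Measurable θ)
    {Ω : Set (EuclideanSpace ℝ (Fin d))} (hΩ : IsCompact Ω)
    (hΩ_cube : Ω ⊆ {x | ∀ i, x i ∈ Set.Icc (0 : ℝ) 1}) {m : ℕ} (hm : 1 ≤ m) :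
    ∃ (L : ℕ) (F : EuclideanSpace ℝ (Fin d) → ℝ),
      (L : ℝ) ≤ 6 * m * ((∫ ξ, (1 + l1Norm ξ) * Real.logb 2 (2 + l1Norm ξ) * r ξ)
        / ∫ ξ, (1 + l1Norm ξ) * r ξ) ∧
      IsReLUNetwork L (d + 4) F ∧
      h1Norm Ω (fun x => waveSum r θ x - F x) ≤ ENNReal.ofReal (4 * Real.pi ^ 2 / √(m : ℝ)
        * volume.real Ω ^ (1 / 2 : ℝ) * ∫ ξ, (1 + l1Norm ξ) * r ξ) := by
  have hP := isProbabilityMeasure_frequencyMeasure hr0 hi hM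
  set M : ℝ := ∫ ξ, (1 + l1Norm ξ) * r ξ with hMdef
  let P : Measure (EuclideanSpace ℝ (Fin d) × unitInterval) := (frequencyMeasure r M).prod volume
  have hfin : IsFiniteMeasure (volume.restrict Ω) :=
    ⟨by rw [Measure.restrict_apply_univ]; exact hΩ.measure_lt_top⟩
  -- An upper bound for the number of layers spent on one sample. Its mean is `3` times the ratio of
  -- the two norms; the factor `2m` from the sampling then gives `6m`.
  let κ : EuclideanSpace ℝ (Fin d) → ℝ := fun ξ => 3 * Real.logb 2 (2 + l1Norm ξ)
  have hκ3 : ∀ ξ, 3 ≤ κ ξ := fun ξ => by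
    have := one_le_logb_two_add_l1Norm ξ
    simp only [κ]
    linarith
  have eκ : (fun ξ => (1 + l1Norm ξ) * r ξ / M * κ ξ)
      = fun ξ => 3 / M * ((1 + l1Norm ξ) * Real.logb 2 (2 + l1Norm ξ) * r ξ) := by
    funext ξ
    simp only [κ]
    ring
  have hκi : Integrable κ (frequencyMeasure r M) := by
    rw [integrable_frequencyMeasure_iff hr hr0 hM, eκ]
    exact hlog.const_mul _
  have hκint : ∫ s, κ s.1 ∂P
      = 3 / M * ∫ ξ, (1 + l1Norm ξ) * Real.logb 2 (2 + l1Norm ξ) * r ξ := by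
    rw [integral_fun_fst, integral_frequencyMeasure hr hr0 hM, eκ, integral_const_mul]
    simp
  have hκP : Integrable (fun s : EuclideanSpace ℝ (Fin d) × unitInterval => κ s.1) P :=
    hκi.comp_fst _
  have hκpos : 0 < ∫ s, κ s.1 ∂P := by
    have h3 : ∫ _, (3 : ℝ) ∂P ≤ ∫ s, κ s.1 ∂P :=
      integral_mono (integrable_const _) hκP fun s => hκ3 s.1
    simp only [integral_const, probReal_univ, one_smul] at h3
    linarith
  obtain ⟨s, hs, hcost⟩ := exists_sample_sq_error_le_and_cost_le (P := P)
    (ν := volume.restrict Ω) (Φ := rampFeature M θ) (measurable_rampFeature M hθ)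
    (V := 4 * Real.pi ^ 4 * M ^ 2) (by have := Real.pi_pos; positivity)
    (sum_rampFeature_sq_le M θ) (κ := fun s => κ s.1) (fun s => by linarith [hκ3 s.1]) hκP hκpos m
  obtain ⟨F, hF, hFQ⟩ := exists_network_average_rampFeature M θ hm s
  have hm0 : (0 : ℝ) < m := by exact_mod_cast hm
  refine ⟨_, F, ?_, hF, ?_⟩
  · push_cast
    refine (Finset.sum_le_sum fun i _ => doublings_add_two_le (s i).1).trans (hcost.trans_eq ?_)
    rw [hκint]
    ring
  · obtain ⟨C₁, hC₁⟩ := exists_lipschitzWith_waveSum hr hr0 hi hθ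
    obtain ⟨C₂, hC₂⟩ := hF.exists_lipschitzWith
    have hmean := fun x => integral_rampFeature hr hr0 hθ hM x
    let E : Option (Fin d) → EuclideanSpace ℝ (Fin d) → ℝ := fun o x =>
      ∑ i, (rampFeature M θ o (s i) x - ∫ s', rampFeature M θ o s' x ∂P)
    have hE : ∀ o x, -(m : ℝ)⁻¹ * E o x = (∫ s', rampFeature M θ o s' x ∂P)
        - (m : ℝ)⁻¹ * ∑ i, rampFeature M θ o (s i) x := fun o x => by
      simp only [E, Finset.sum_sub_distrib, Finset.sum_const, Finset.card_univ, Fintype.card_fin,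
        nsmul_eq_mul]
      field_simp
      ring
    have hEi : ∀ o, Integrable (fun x => (-(m : ℝ)⁻¹ * E o x) ^ 2) (volume.restrict Ω) := by
      intro o
      have hmeas : Measurable (E o) := Finset.measurable_fun_sum _ fun i _ =>
        ((measurable_rampFeature M hθ o).comp measurable_prodMk_left).sub
          (measurable_rampFeature M hθ o).stronglyMeasurable.integral_prod_left.measurable
      refine Integrable.of_bound ((hmeas.const_mul _).pow_const 2).aestronglyMeasurable
        (((m : ℝ)⁻¹ * (m * (2 * √(4 * Real.pi ^ 4 * M ^ 2)))) ^ 2)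
        (Filter.Eventually.of_forall fun x => ?_)
      rw [Real.norm_eq_abs, abs_pow, abs_mul, abs_neg, abs_of_pos (inv_pos.2 hm0)]
      have hg : |∫ s', rampFeature M θ o s' x ∂P| ≤ √(4 * Real.pi ^ 4 * M ^ 2) := by
        have := norm_integral_le_of_norm_le_const (μ := P) (f := fun s' => rampFeature M θ o s' x)
          (Filter.Eventually.of_forall fun s' => abs_rampFeature_le M θ o s' x)
        simpa using this
      gcongr
      refine (Finset.abs_sum_le_sum_abs _ _).trans ((Finset.sum_le_sum fun i _ =>
        (abs_sub _ _).trans (add_le_add (abs_rampFeature_le M θ o (s i) x) hg)).trans_eq ?_)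
      simp
      ring
    refine h1Norm_le_of_lipschitzWith (hC₁.sub hC₂) hEi ?_ (fun j => ?_)
      (by positivity) ?_
    · filter_upwards [ae_restrict_mem hΩ.measurableSet] with x hx
      rw [hE, hFQ x (hΩ_cube hx), (hmean x).1, waveSum]
    · filter_upwards [ae_mem_interior_cube hΩ.measurableSet hΩ_cube,
        ae_restrict_of_ae (ae_lineDeriv_waveSum_sub_network hr hr0 hi hθ hFQ j)] with x hx hd
      rw [hd hx, hE, (hmean x).2 j]
    · simp only [mul_pow, integral_const_mul, ← Finset.mul_sum]
      have hs' : ∑ o, ∫ x in Ω, E o x ^ 2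
          ≤ 2 * m * (4 * Real.pi ^ 4 * M ^ 2 * volume.real Ω) := by
        simpa only [measureReal_restrict_apply_univ] using hs
      rw [← Real.sqrt_eq_rpow, Real.sq_sqrt measureReal_nonneg, div_pow, Real.sq_sqrt hm0.le]
      calc (-(m : ℝ)⁻¹) ^ 2 * ∑ o, ∫ x in Ω, E o x ^ 2
          ≤ (-(m : ℝ)⁻¹) ^ 2 * (2 * m * (4 * Real.pi ^ 4 * M ^ 2 * volume.real Ω)) := by gcongr
        -- The constant `4π²` has room to spare: the squared error obtained is half of what is
        -- claimed.
        _ = 1 / 2 * ((4 * Real.pi ^ 2) ^ 2 / m * volume.real Ω * M ^ 2) := by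
            field_simp
            ring
        _ ≤ (4 * Real.pi ^ 2) ^ 2 / m * volume.real Ω * M ^ 2 := by
            have : 0 ≤ (4 * Real.pi ^ 2) ^ 2 / m * volume.real Ω * M ^ 2 := by positivity
            linarith

theorem mainTheorem5 (d : ℕ) (hd : 1 ≤ d) (f : 𝓢'(EuclideanSpace ℝ (Fin d), ℂ))
    (hf : f ∈ logBarronSpace d 1) (hf_real : IsRealDistribution f) (hf_ne : f ≠ 0)
    (Ω : Set (EuclideanSpace ℝ (Fin d))) (hΩ : IsCompact Ω)
    (hΩ_cube : Ω ⊆ {x | ∀ i, x i ∈ Set.Icc (0 : ℝ) 1}) (m : ℕ) (hm : 1 ≤ m) :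
    ∃ (u : EuclideanSpace ℝ (Fin d) → ℝ) (L : ℕ) (F : EuclideanSpace ℝ (Fin d) → ℝ),
      IsGivenByFunction f (fun x => (u x : ℂ)) ∧
      (L : ℝ) ≤ 6 * m * ((logBarronNorm 1 f).toReal / (barronNorm 1 f).toReal) ∧
      IsReLUNetwork L (d + 4) F ∧
      h1Norm Ω (fun x => u x - F x) ≤
        ENNReal.ofReal (4 * Real.pi ^ 2 / √(m : ℝ) * volume.real Ω ^ (1 / 2 : ℝ)
          * (barronNorm 1 f).toReal) := by
  obtain ⟨g, hgm, hg, hi, hlog, hbar, hlogbar, hM⟩ := exists_fourier_density hf hf_ne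
  have hgi : Integrable g := by
    refine hi.mono' hgm.aestronglyMeasurable (Filter.Eventually.of_forall fun ξ => ?_)
    exact le_mul_of_one_le_left (norm_nonneg _) (by linarith [l1Norm_nonneg ξ])
  have hθ : Measurable fun ξ => (g ξ).arg / (2 * Real.pi) :=
    (Complex.measurable_arg.comp hgm).div_const _
  obtain ⟨L, F, hL, hF, hh⟩ := exists_network_h1Norm_waveSum_sub_le hgm.norm
    (fun ξ => norm_nonneg _) hi hlog hM hθ hΩ hΩ_cube hm
  refine ⟨_, L, F, ?_, by rwa [hbar, hlogbar], hF, by rwa [hbar]⟩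
  -- The superposition is the real part of `𝓕⁻ g`, which represents `f` because `f` is real.
  have hu : waveSum (fun ξ => ‖g ξ‖) (fun ξ => (g ξ).arg / (2 * Real.pi))
      = fun x => (𝓕⁻ g x).re := funext fun x => (fourierInv_re_eq hgi x).symm
  rw [hu]
  exact (hg.fourierInv hgi).of_isRealDistribution hf_real
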